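/- Let $H$ be a finite dimensional $C^*$-Hopf algebra (a finite dimensional Hopf algebra over $\mathbf C$ that is a $C^*$-algebra and whose comultiplication and counit are $*$-homomorphisms), with comultiplication $\Delta(h)=h_{(1)}\otimes h_{(2)}$, counit $\epsilon$ and antipode $S$. Let $H^0$ be the dual $C^*$-Hopf algebra: the space of linear functionals on $H$ with product $(\phi\psi)(h)=\phi(h_{(1)})\psi(h_{(2)})$, unit $1^0=\epsilon$, involution $\phi^*(h)=\overline{\phi(S(h)^*)}$, counit $\epsilon^0(\phi)=\phi(1)$ and comultiplication $\Delta^0(\phi)(h\otimes l)=\phi(hl)$. Let $\tau$ be the distinguished projection of $H^0$, i.e. the nonzero projection with $\phi\tau=\tau\phi=\epsilon^0(\phi)\tau$ for all $\phi\in H^0$ (the Haar trace on $H$). Let $A$ be a unital $C^*$-algebra and let $\rho$ be a coaction of $H^0$ on $A$, i.e. a $*$-homomorphism $\rho:A\to A\otimes H^0$ such that $\overline{\rho(A)(A\otimes H^0)}=A\otimes H^0$, $(\mathrm{id}\otimes\epsilon^0)\circ\rho=\mathrm{id}$ and $(\rho\otimes\mathrm{id})\circ\rho=(\mathrm{id}\otimes\Delta^0)\circ\rho$.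 Put $h\cdot_\rho a=(\mathrm{id}\otimes h)(\rho(a))$ for $h\in H$, $a\in A$. Let $A\rtimes_\rho H$ be the crossed product, i.e. the linear space $A\otimes H$, with elementary tensors written $a\rtimes_\rho h$, with product $(a\rtimes_\rho h)(b\rtimes_\rho l)=a\,(h_{(1)}\cdot_\rho b)\rtimes_\rho h_{(2)}l$ and involution $(a\rtimes_\rho h)^*=(h_{(1)}^*\cdot_\rho a^*)\rtimes_\rho h_{(2)}^*$. Identify $a\in A$ with $a\rtimes_\rho 1$, and let $E_1^\rho:A\rtimes_\rho H\to A$ be the linear map with $E_1^\rho(a\rtimes_\rho h)=\tau(h)a$. Conditional expectations onto $A$ are the positive $A$-bimodule linear maps $A\rtimes_\rho H\to A$ that restrict to the identity on $A$. Then the following three conditions are equivalent: 1. $\rho$ is free, that is, every $x\in A\otimes H^0$ satisfying $x\rho(a)=(a\otimes 1^0)x$ for all $a\in A$ belongs to $(A'\cap A)\otimes\mathbf C\tau$; 2. $A'\cap(A\rtimes_\rho H)=A'\cap A$; 3. $E_1^\rho$ is the unique conditional expectation from $A\rtimes_\rho H$ onto $A$. -/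

import Mathlib

open scoped TensorProduct

noncomputable section

namespace CStarHopf

universe u v

/-- A finite dimensional C*-Hopf algebra: a finite dimensional Hopf algebra over `ℂ` which is a
C*-algebra and whose comultiplication and counit are `*`-homomorphisms. -/
class FinDimCStarHopfAlgebra (H : Type v) extends CStarAlgebra H, HopfAlgebra ℂ H where
  finiteDimensional : FiniteDimensional ℂ H
  comul_star : ∀ h : H,
    Coalgebra.comul (R := ℂ) (Star.star h) = Star.star (Coalgebra.comul (R := ℂ) h)
  counit_star : ∀ h : H,
    Coalgebra.counit (R := ℂ) (Star.star h) = Star.star (Coalgebra.counit (R := ℂ) h)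

attribute [instance] FinDimCStarHopfAlgebra.finiteDimensional

open Coalgebra HopfAlgebra

section Antipode

variable {H : Type v} [FinDimCStarHopfAlgebra H]

theorem antipode_star_antipode_star (h : H) :
    antipode ℂ (star (antipode ℂ (star h))) = h := by
  let f : H →ₗ[ℂ] H :=
    { toFun := fun h => antipode ℂ (star (antipode ℂ (star h)))
      map_add' := by intro x y; simp
      map_smul' := by intro c x; simp }
  have h1 : WithConv.toConv (LinearMap.id : H →ₗ[ℂ] H) * WithConv.toConv (antipode ℂ) = 1 := by
    ext x
    simp
  have h2 : WithConv.toConv (antipode ℂ : H →ₗ[ℂ] H) * WithConv.toConv f = 1 := by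
    ext x
    have hs : ∑ i ∈ (ℛ ℂ x).index,
        star ((ℛ ℂ x).left i) * antipode ℂ (star ((ℛ ℂ x).right i))
          = algebraMap ℂ H (counit (star x)) := by
      have key := congrArg (fun y => LinearMap.mul' ℂ H ((antipode ℂ).lTensor H y))
        (FinDimCStarHopfAlgebra.comul_star x)
      simp only [mul_antipode_lTensor_comul_apply] at key
      rw [key, ← (ℛ ℂ x).eq]
      simp
    have hs' := congrArg (fun y => antipode ℂ (star y)) hs
    simp only [star_sum, star_mul, star_star, map_sum, antipode_mul_antidistrib,
      FinDimCStarHopfAlgebra.counit_star] at hs'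
    simp only [(ℛ ℂ x).convMul_apply]
    refine Eq.trans hs' ?_
    simp [Algebra.algebraMap_eq_smul_one]
  have h3 := left_inv_eq_right_inv h1 h2
  exact (congrArg (fun g : WithConv (H →ₗ[ℂ] H) => g.ofConv h) h3).symm

end Antipode

/-- The dual C*-Hopf algebra `H⁰` of `H`: the space of linear functionals on `H`, with the
convolution product `(φ ψ)(h) = φ(h₍₁₎) ψ(h₍₂₎)` and the unit `ε`. -/
def Dual (H : Type v) [FinDimCStarHopfAlgebra H] : Type v := WithConv (H →ₗ[ℂ] ℂ)

namespace Dual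

variable (H : Type v) [FinDimCStarHopfAlgebra H]

instance : Ring (Dual H) := inferInstanceAs (Ring (WithConv (H →ₗ[ℂ] ℂ)))

instance : Algebra ℂ (Dual H) := inferInstanceAs (Algebra ℂ (WithConv (H →ₗ[ℂ] ℂ)))

/-- The identification of `H⁰` with the space of functionals on `H`. -/
def toFunctional : Dual H ≃ₗ[ℂ] Module.Dual ℂ H := WithConv.linearEquiv ℂ (H →ₗ[ℂ] ℂ)

instance : FunLike (Dual H) H ℂ where
  coe φ := toFunctional H φ
  coe_injective := DFunLike.coe_injective.comp (toFunctional H).injective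

instance : LinearMapClass (Dual H) ℂ H ℂ where
  map_add φ := (toFunctional H φ).map_add
  map_smulₛₗ φ := (toFunctional H φ).map_smul

variable {H}

@[simp] theorem toFunctional_apply (φ : Dual H) (h : H) : toFunctional H φ h = φ h := rfl

@[ext] theorem ext {φ ψ : Dual H} (w : ∀ h, φ h = ψ h) : φ = ψ := DFunLike.ext _ _ w

theorem mul_apply (φ ψ : Dual H) {h : H} {ι : Type*} (𝓡 : Coalgebra.Repr ℂ h ι) :
    (φ * ψ) h = ∑ i ∈ 𝓡.index, φ (𝓡.left i) * ψ (𝓡.right i) :=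
  𝓡.convMul_apply (A := ℂ) φ ψ

theorem one_apply (h : H) : (1 : Dual H) h = counit (R := ℂ) h := rfl

/-- The involution `φ*(h) = conj φ(S(h)*)`. -/
instance : Star (Dual H) where
  star φ := (toFunctional H).symm
    { toFun := fun h => star (toFunctional H φ (star (antipode ℂ h)))
      map_add' := by intro x y; simp
      map_smul' := by intro c x; simp }

theorem star_apply (φ : Dual H) (h : H) : (star φ) h = star (φ (star (antipode ℂ h))) := rfl

instance : StarAddMonoid (Dual H) where
  star_involutive φ := by
    ext h
    rw [star_apply, star_apply, star_star]
    have := antipode_star_antipode_star (star h)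
    rw [star_star] at this
    rw [this, star_star]
  star_add φ ψ := by
    ext h
    exact star_add (φ (star (antipode ℂ h))) (ψ (star (antipode ℂ h)))

instance : StarModule ℂ (Dual H) where
  star_smul c φ := by
    ext h
    exact star_smul c (φ (star (antipode ℂ h)))

variable (H)

/-- The counit `ε⁰(φ) = φ(1)` of `H⁰`. -/
def counit : Dual H →ₗ[ℂ] ℂ := LinearMap.applyₗ (1 : H) ∘ₗ (toFunctional H).toLinearMap

/-- The comultiplication `Δ⁰` of `H⁰`, determined by `Δ⁰(φ)(h ⊗ l) = φ(h l)`. -/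
def comul : Dual H →ₗ[ℂ] Dual H ⊗[ℂ] Dual H :=
  (TensorProduct.congr (toFunctional H).symm (toFunctional H).symm).toLinearMap ∘ₗ
    (TensorProduct.dualDistribEquiv ℂ H H).symm.toLinearMap ∘ₗ
    (LinearMap.mul' ℂ H).dualMap ∘ₗ (toFunctional H).toLinearMap

/-- The evaluation functional on `H⁰` given by `h ∈ H`. -/
def eval (h : H) : Dual H →ₗ[ℂ] ℂ := LinearMap.applyₗ h ∘ₗ (toFunctional H).toLinearMap

variable {H} in
/-- `τ` is a distinguished projection of `H⁰`: a nonzero projection with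
`φ τ = ε⁰(φ) τ = τ φ` for all `φ ∈ H⁰`. There is exactly one. -/
structure IsDistinguishedProjection (τ : Dual H) : Prop where
  isStarProjection : IsStarProjection τ
  ne_zero : τ ≠ 0
  mul_left : ∀ φ : Dual H, φ * τ = counit H φ • τ
  mul_right : ∀ φ : Dual H, τ * φ = counit H φ • τ

/-- The distinguished projection `τ` of `H⁰`, which as a functional on `H` is the Haar trace. -/
def tau : Dual H := Classical.epsilon IsDistinguishedProjection

end Dual

section Coaction

variable (A : Type u) [CStarAlgebra A] (H : Type v) [FinDimCStarHopfAlgebra H]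

variable {H} in
/-- The slice map `id ⊗ h : A ⊗ H⁰ → A`, `a ⊗ φ ↦ φ(h) a`. -/
def slice (h : H) : A ⊗[ℂ] Dual H →ₗ[ℂ] A :=
  (TensorProduct.rid ℂ A).toLinearMap ∘ₗ (Dual.eval H h).lTensor A

/-- The topology of the C*-algebra `A ⊗ H⁰`. Since `H⁰` is finite dimensional, `A ⊗ H⁰` is the
algebraic tensor product, isomorphic to `A ^ dim H` through the slice maps, and its norm topology is
the topology of convergence of all slices. -/
@[reducible] def tensorTopology : TopologicalSpace (A ⊗[ℂ] Dual H) :=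
  TopologicalSpace.induced (fun x (h : H) => slice A h x) inferInstance

/-- A coaction of `H⁰` on the unital C*-algebra `A`: a `*`-homomorphism `ρ : A → A ⊗ H⁰` with
`ρ(A)(A ⊗ H⁰)` dense in `A ⊗ H⁰`, `(id ⊗ ε⁰) ∘ ρ = id` and
`(ρ ⊗ id) ∘ ρ = (id ⊗ Δ⁰) ∘ ρ`. -/
structure Coaction extends A →⋆ₙₐ[ℂ] (A ⊗[ℂ] Dual H) where
  nondegenerate :
    @closure _ (tensorTopology A H)
      (Submodule.span ℂ {z : A ⊗[ℂ] Dual H | ∃ a x, z = toFun a * x} : Set (A ⊗[ℂ] Dual H))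
        = Set.univ
  counit_comp : ∀ a : A, TensorProduct.rid ℂ A ((Dual.counit H).lTensor A (toFun a)) = a
  coassoc : ∀ a : A,
    TensorProduct.assoc ℂ A (Dual H) (Dual H)
        (LinearMap.rTensor (Dual H) (toNonUnitalStarAlgHom : A →ₗ[ℂ] A ⊗[ℂ] Dual H) (toFun a))
      = (Dual.comul H).lTensor A (toFun a)

variable {A H}

instance : CoeFun (Coaction A H) (fun _ => A → A ⊗[ℂ] Dual H) where
  coe ρ := ρ.toNonUnitalStarAlgHom

namespace Coaction

variable (ρ : Coaction A H)

/-- `ρ` as a linear map. -/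
def linear : A →ₗ[ℂ] A ⊗[ℂ] Dual H := (ρ.toNonUnitalStarAlgHom : A →ₗ[ℂ] A ⊗[ℂ] Dual H)

/-- The action `h ·_ρ a = (id ⊗ h)(ρ(a))` of `H` on `A` induced by `ρ`. -/
def act : H →ₗ[ℂ] A →ₗ[ℂ] A where
  toFun h := slice A h ∘ₗ ρ.linear
  map_add' h l := by
    have : Dual.eval H (h + l) = Dual.eval H h + Dual.eval H l := by
      ext φ; simp [Dual.eval]
    ext a
    simp [slice, this, LinearMap.lTensor_add]
  map_smul' c h := by
    have : Dual.eval H (c • h) = c • Dual.eval H h := by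
      ext φ; simp [Dual.eval]
    ext a
    simp [slice, this, LinearMap.lTensor_smul]

theorem act_apply (h : H) (a : A) : ρ.act h a = slice A h (ρ a) := rfl

/-- `ρ` is free: an element `x ∈ A ⊗ H⁰` with `x ρ(a) = (a ⊗ 1⁰) x` for all `a ∈ A` lies in
`(A' ∩ A) ⊗ ℂ τ`. (As `A` is unital, `M(A) = A`.) -/
def IsFree : Prop :=
  ∀ x : A ⊗[ℂ] Dual H, (∀ a : A, x * ρ a = (a ⊗ₜ[ℂ] (1 : Dual H)) * x) →
    ∃ c ∈ Set.center A, x = c ⊗ₜ[ℂ] Dual.tau H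

/-- The linear map `H ⊗ A → A ⊗ H`, `h ⊗ a ↦ (h₍₁₎ ·_ρ a) ⊗ h₍₂₎`. -/
def twist : H ⊗[ℂ] A →ₗ[ℂ] A ⊗[ℂ] H :=
  TensorProduct.lift
    (LinearMap.mk₂ ℂ (fun (h : H) (a : A) => (ρ.act.flip a).rTensor H (Coalgebra.comul h))
      (by intro x y a; simp)
      (by intro c x a; simp)
      (by intro x a b; simp [LinearMap.rTensor_add])
      (by intro c x a; simp [LinearMap.rTensor_smul]))

theorem twist_tmul {h : H} {ι : Type*} (𝓡 : Coalgebra.Repr ℂ h ι) (a : A) :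
    ρ.twist (h ⊗ₜ a) = ∑ i ∈ 𝓡.index, ρ.act (𝓡.left i) a ⊗ₜ[ℂ] 𝓡.right i := by
  simp [twist, ← 𝓡.eq]

end Coaction

/-- The crossed product `A ⋊_ρ H`; as `H` is finite dimensional, its underlying linear space is
the algebraic tensor product, with `a ⋊ h` the elementary tensor. -/
def CrossedProduct (_ρ : Coaction A H) : Type (max u v) := A ⊗[ℂ] H

namespace CrossedProduct

variable (ρ : Coaction A H)

instance : AddCommGroup (CrossedProduct ρ) := inferInstanceAs (AddCommGroup (A ⊗[ℂ] H))

instance : Module ℂ (CrossedProduct ρ) := inferInstanceAs (Module ℂ (A ⊗[ℂ] H))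

/-- The element `a ⋊_ρ h`. -/
def of (a : A) (h : H) : CrossedProduct ρ := a ⊗ₜ[ℂ] h

/-- The product of `A ⋊_ρ H` as a bilinear map:
`(a ⋊ h, b ⋊ l) ↦ a (h₍₁₎ ·_ρ b) ⋊ h₍₂₎ l`. -/
def mulMap : A ⊗[ℂ] H →ₗ[ℂ] A ⊗[ℂ] H →ₗ[ℂ] A ⊗[ℂ] H :=
  TensorProduct.lift
    (LinearMap.mk₂ ℂ
      (fun (a : A) (h : H) => TensorProduct.lift
        (LinearMap.mk₂ ℂ
          (fun (b : A) (l : H) =>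
            (a ⊗ₜ[ℂ] (1 : H)) * ρ.twist (h ⊗ₜ b) * ((1 : A) ⊗ₜ[ℂ] l))
          (by intro x y l; simp [TensorProduct.tmul_add, mul_add, add_mul])
          (by intro c x l; simp)
          (by intro b x y; simp [TensorProduct.tmul_add, mul_add])
          (by intro c x l; simp)))
      (by intro x y h; ext b l; simp [TensorProduct.add_tmul, add_mul])
      (by intro c x h; ext b l; simp [← TensorProduct.smul_tmul'])
      (by intro x h k; ext b l; simp [TensorProduct.add_tmul, mul_add, add_mul])
      (by intro c x h; ext b l; simp [← TensorProduct.smul_tmul']))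

instance : Mul (CrossedProduct ρ) where
  mul x y := mulMap ρ x y

/-- The involution `(a ⋊ h)* = (h₍₁₎* ·_ρ a*) ⋊ h₍₂₎*`. -/
instance : Star (CrossedProduct ρ) where
  star x := ρ.twist (TensorProduct.comm ℂ A H (star (show A ⊗[ℂ] H from x)))

theorem of_mul_of (a b : A) (h l : H) {ι : Type*} (𝓡 : Coalgebra.Repr ℂ h ι) :
    of ρ a h * of ρ b l
      = ∑ i ∈ 𝓡.index, of ρ (a * ρ.act (𝓡.left i) b) (𝓡.right i * l) := by
  change mulMap ρ (a ⊗ₜ h) (b ⊗ₜ l) =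
    ∑ i ∈ 𝓡.index, (a * ρ.act (𝓡.left i) b) ⊗ₜ[ℂ] (𝓡.right i * l)
  simp [mulMap, ρ.twist_tmul 𝓡, Finset.mul_sum, Finset.sum_mul]

theorem star_of (a : A) (h : H) {ι : Type*} (𝓡 : Coalgebra.Repr ℂ h ι) :
    star (of ρ a h)
      = ∑ i ∈ 𝓡.index, of ρ (ρ.act (star (𝓡.left i)) (star a)) (star (𝓡.right i)) := by
  change ρ.twist (star h ⊗ₜ star a) =
    ∑ i ∈ 𝓡.index, (ρ.act (star (𝓡.left i)) (star a)) ⊗ₜ[ℂ] (star (𝓡.right i))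
  simp [Coaction.twist, FinDimCStarHopfAlgebra.comul_star, ← 𝓡.eq]

/-- The copy of `A` in `A ⋊_ρ H`, through `a ↦ a ⋊ 1`. -/
def copy : Set (CrossedProduct ρ) := Set.range fun a : A => of ρ a 1

variable {ρ} in
/-- `F` is a conditional expectation from `A ⋊_ρ H` onto `A`: a positive `A`-bimodule map
restricting to the identity on `A`. (An element of a C*-algebra is positive exactly when it
has the form `y* y`.) -/
structure IsCondExp (F : CrossedProduct ρ →ₗ[ℂ] A) : Prop where
  apply_of : ∀ a : A, F (of ρ a 1) = a
  mul_left : ∀ (a : A) (x : CrossedProduct ρ), F (of ρ a 1 * x) = a * F x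
  mul_right : ∀ (x : CrossedProduct ρ) (a : A), F (x * of ρ a 1) = F x * a
  positive : ∀ x : CrossedProduct ρ, ∃ y : A, F (star x * x) = star y * y

/-- The canonical conditional expectation `E₁^ρ(a ⋊ h) = τ(h) a`. -/
def canonicalCondExp : CrossedProduct ρ →ₗ[ℂ] A :=
  (TensorProduct.rid ℂ A).toLinearMap ∘ₗ
    (Dual.toFunctional H (Dual.tau H)).lTensor A

theorem canonicalCondExp_of (a : A) (h : H) :
    canonicalCondExp ρ (of ρ a h) = Dual.tau H h • a := by
  change (TensorProduct.rid ℂ A)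
    ((Dual.toFunctional H (Dual.tau H)).lTensor A (a ⊗ₜ[ℂ] h)) = _
  simp

end CrossedProduct

end Coaction

end CStarHopf

end

/-! Write `E` for the canonical expectation, V(h) for 1 ⋊ h, and ω for the Haar functional. All
three conditions are compared with one statement: every y in the crossed product commuting with A
lies in A (`centralizer_copy_eq_iff`).

The functional ω is the normalized trace of the regular representation. It is positive and faithful
by spectral theory, and idempotent for convolution because Δ(x)(1 ⊗ y) untwists the regular
representation of H ⊗ H restricted along Δ. A faithful idempotent is invariant, and invariance
identifies ω with τ (`Dual.toFunctional_tau`). A basis e_i orthonormal for ω then gives a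
reconstruction formula y = ∑ E(y V(e_i)) V(e_i)*. So y is determined by the map k ↦ E(y V(k)), and
every linear map H → A arises this way.

Freeness: y ↦ (h ↦ E(y V(S h))) is a bijection onto Hom(H, A) = A ⊗ H⁰. It turns commutation with A
into the intertwining relation x ρ(a) = (a ⊗ 1)x (`commute_iff_intertwines`, `mul_coaction_eq_iff`),
and it sends c ∈ A to c ⊗ τ because ω ∘ S = ω.

Uniqueness from a trivial commutant: an expectation F is right A-linear, so F = E(y ·). Left
linearity makes y commute with A, hence y ∈ A, and F(1) = 1 forces y = 1.

Trivial commutant from uniqueness: if y commutes with A, then x ↦ (1 - t² E(y*y)) E(x) + t² E(y* x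
y) is an expectation for small t > 0 (`perturbed_isCondExp`), so it equals E. Thus E(y* x y) =
E(y*y) E(x), and polarizing against 1 yields E(yx) = E(y)E(x), that is, y = E(y). -/

open scoped TensorProduct

noncomputable section

namespace CStarHopf

open Coalgebra HopfAlgebra WithConv ComplexOrder

/-! ### Faithful positive functionals and their inner products -/

section FaithfulFunctional

variable {B : Type*} [Ring B] [StarRing B] [Algebra ℂ B]

/-- A linear functional on a `*`-algebra that is positive and faithful. -/
def IsFaithfulPositive (ω : B →ₗ[ℂ] ℂ) : Prop := ∀ b : B, b ≠ 0 → 0 < ω (star b * b)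

namespace IsFaithfulPositive

variable {ω : B →ₗ[ℂ] ℂ}

theorem nonneg (hω : IsFaithfulPositive ω) (b : B) : 0 ≤ ω (star b * b) := by
  by_cases hb : b = 0
  · simp [hb]
  · exact (hω b hb).le

theorem eq_zero (hω : IsFaithfulPositive ω) {b : B} (h : ω (star b * b) = 0) : b = 0 := by
  by_contra hb
  exact (hω b hb).ne' h

variable [StarModule ℂ B]

theorem conj_symm (hω : IsFaithfulPositive ω) (a b : B) :
    star (ω (star b * a)) = ω (star a * b) := by
  have im (x : B) : (ω (star x * x)).im = 0 := (Complex.nonneg_iff.mp (hω.nonneg x)).2.symm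
  -- Polarization: reality of ω on these two squares gives the imaginary and real parts of the
  -- identity.
  have h1 := im (a + b)
  have h2 := im (a + Complex.I • b)
  simp only [star_add, add_mul, mul_add, map_add, Complex.add_im, im, star_smul, smul_mul_assoc,
    mul_smul_comm, map_smul] at h1 h2
  simp [im, Complex.add_im] at h1 h2
  apply Complex.ext
  · simp; linarith
  · simp; linarith

theorem map_star (hω : IsFaithfulPositive ω) (a : B) : ω (star a) = star (ω a) := by
  have := hω.conj_symm a 1
  simpa using this.symm

theorem exists_orthonormal_basis [FiniteDimensional ℂ B] (hω : IsFaithfulPositive ω) :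
    ∃ e : Module.Basis (Fin (Module.finrank ℂ B)) ℂ B,
      ∀ i j, ω (star (e i) * e j) = if i = j then 1 else 0 := by
  let c : InnerProductSpace.Core ℂ B :=
    { inner := fun a b => ω (star a * b)
      conj_inner_symm := fun a b => hω.conj_symm a b
      re_inner_nonneg := fun a => (Complex.nonneg_iff.mp (hω.nonneg a)).1
      add_left := fun a b d => by simp [add_mul]
      smul_left := fun a b r => by simp
      definite := fun a h => hω.eq_zero h }
  let : NormedAddCommGroup B := c.toNormedAddCommGroup
  let : InnerProductSpace ℂ B := InnerProductSpace.ofCore c.toCore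
  refine ⟨(stdOrthonormalBasis ℂ B).toBasis, fun i j => ?_⟩
  have := orthonormal_iff_ite.mp (stdOrthonormalBasis ℂ B).orthonormal i j
  rw [OrthonormalBasis.coe_toBasis]
  exact this

/-- The product functional of a faithful positive functional with itself detects zero. -/
theorem tensor_eq_zero [FiniteDimensional ℂ B] (hω : IsFaithfulPositive ω) {q : B ⊗[ℂ] B}
    (h : LinearMap.mul' ℂ ℂ (TensorProduct.map ω ω (star q * q)) = 0) : q = 0 := by
  obtain ⟨e, he⟩ := hω.exists_orthonormal_basis
  -- Expanding the first leg in an orthonormal basis turns the hypothesis into ∑ ω(k_i* k_i) = 0, a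
  -- sum of nonnegative terms.
  obtain ⟨k, rfl⟩ : ∃ k : Fin (Module.finrank ℂ B) → B, q = ∑ i, e i ⊗ₜ k i := by
    clear h
    induction q using TensorProduct.induction_on with
    | zero => exact ⟨0, by simp⟩
    | tmul a b =>
      refine ⟨fun i => e.repr a i • b, ?_⟩
      conv_lhs => rw [← e.sum_repr a]
      simp only [TensorProduct.sum_tmul, TensorProduct.smul_tmul]
    | add x y hx hy =>
      obtain ⟨k, hk⟩ := hx
      obtain ⟨l, hl⟩ := hy
      exact ⟨k + l, by simp [hk, hl, TensorProduct.tmul_add, Finset.sum_add_distrib]⟩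
  have h' : ∑ i, ω (star (k i) * k i) = 0 := by
    rw [← h]
    simp [star_sum, Finset.sum_mul, Finset.mul_sum, he]
  have := (Finset.sum_eq_zero_iff_of_nonneg (fun i _ => hω.nonneg (k i))).mp h'
  exact Finset.sum_eq_zero fun i hi => by rw [hω.eq_zero (this i hi)]; simp

end IsFaithfulPositive

end FaithfulFunctional

/-! ### Convolution inverses given by the antipode -/

section Convolution

variable {H : Type*} [Ring H] [HopfAlgebra ℂ H] {B : Type*} [Ring B] [Algebra ℂ B]

theorem conv_algHom_antipode (f : H →ₐ[ℂ] B) :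
    toConv f.toLinearMap * toConv (f.toLinearMap ∘ₗ antipode ℂ) = 1 := by
  have := LinearMap.algHom_comp_convMul_distrib f (toConv LinearMap.id) (toConv (antipode ℂ))
  rw [LinearMap.id_mul_antipode] at this
  apply ofConv_injective
  simp at this
  rw [← this]
  ext
  simp

theorem conv_antipode_algHom (f : H →ₐ[ℂ] B) :
    toConv (f.toLinearMap ∘ₗ antipode ℂ) * toConv f.toLinearMap = 1 := by
  have := LinearMap.algHom_comp_convMul_distrib f (toConv (antipode ℂ)) (toConv LinearMap.id)
  rw [LinearMap.antipode_mul_id] at this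
  apply ofConv_injective
  simp at this
  rw [← this]
  ext
  simp

/-- Both sides are convolution inverses of Δ. On one side is Δ ∘ S, since Δ is an algebra map. The
other comes from factoring Δ as the convolution product of the two inclusions H → H ⊗ H and
inverting the factors in reverse order. -/
theorem comul_antipode (h : H) {ι : Type*} (𝓡 : Coalgebra.Repr ℂ h ι) :
    comul (R := ℂ) (antipode ℂ h)
      = ∑ i ∈ 𝓡.index, antipode ℂ (𝓡.right i) ⊗ₜ[ℂ] antipode ℂ (𝓡.left i) := by
  let i₁ : H →ₐ[ℂ] H ⊗[ℂ] H := Algebra.TensorProduct.includeLeft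
  let i₂ : H →ₐ[ℂ] H ⊗[ℂ] H := Algebra.TensorProduct.includeRight
  have hΔ : toConv (Bialgebra.comulAlgHom ℂ H).toLinearMap
      = toConv i₁.toLinearMap * toConv i₂.toLinearMap := by
    ext x
    rw [(ℛ ℂ x).convMul_apply]
    simp [i₁, i₂, (ℛ ℂ x).eq]
  have h2 := conv_algHom_antipode (Bialgebra.comulAlgHom ℂ H)
  have h1 : (toConv (i₂.toLinearMap ∘ₗ antipode ℂ) * toConv (i₁.toLinearMap ∘ₗ antipode ℂ)) *
      toConv (Bialgebra.comulAlgHom ℂ H).toLinearMap = 1 := by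
    rw [hΔ, mul_assoc, ← mul_assoc (toConv (i₁.toLinearMap ∘ₗ antipode ℂ)),
      conv_antipode_algHom, one_mul, conv_antipode_algHom]
  have := congrArg (fun g : WithConv (H →ₗ[ℂ] H ⊗[ℂ] H) => g h) (left_inv_eq_right_inv h1 h2)
  simp only [𝓡.convMul_apply] at this
  simpa [i₁, i₂] using this.symm

end Convolution

/-! ### Faithfulness of the regular trace -/

section RegularTrace

/-- The trace of the left regular representation. -/
def regularTrace (B : Type*) [Ring B] [Algebra ℂ B] : B →ₗ[ℂ] ℂ :=
  LinearMap.trace ℂ B ∘ₗ (Algebra.lmul ℂ B).toLinearMap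

theorem regularTrace_apply {B : Type*} [Ring B] [Algebra ℂ B] (b : B) :
    regularTrace B b = LinearMap.trace ℂ B (LinearMap.mulLeft ℂ b) := rfl

/-- The eigenvalues of left multiplication by b*b form its spectrum, which is nonnegative. If their
sum vanishes, the spectral radius is zero, and for a self-adjoint element this is the norm. -/
theorem regularTrace_isFaithfulPositive (B : Type*) [CStarAlgebra B] [FiniteDimensional ℂ B] :
    IsFaithfulPositive (regularTrace B) := by
  intro b hb
  have : Nontrivial B := ⟨b, 0, hb⟩
  have hsa : IsSelfAdjoint (star b * b) := .star_mul_self b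
  set f : Module.End ℂ B := Algebra.lmul ℂ B (star b * b) with hf
  have hspec : ∀ z, z ∈ spectrum ℂ (star b * b) ↔ z ∈ f.charpoly.roots := by
    intro z
    rw [Polynomial.mem_roots f.charpoly_monic.ne_zero, ← Module.End.mem_spectrum_iff_isRoot_charpoly,
      spectrum.mem_iff, spectrum.mem_iff, hf, ← (Algebra.lmul ℂ B).commutes, ← map_sub,
      Algebra.lmul_isUnit_iff]
  have hroot : ∀ z ∈ f.charpoly.roots, 0 ≤ z := by
    intro z hz
    rw [← hspec] at hz
    have hre := hsa.mem_spectrum_eq_re hz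
    rw [hre] at hz
    rw [hre]
    exact Complex.zero_le_real.mpr
      (spectrum_star_mul_self_nonneg _ ((spectrum.algebraMap_mem_iff ℂ).mp hz))
  have htr : regularTrace B (star b * b) = f.charpoly.roots.sum :=
    Module.End.trace_eq_sum_roots_charpoly_of_splits (IsAlgClosed.splits _)
  rw [htr]
  refine lt_of_le_of_ne (Multiset.sum_nonneg hroot) fun h0 => hb ?_
  have hzero : ∀ z ∈ f.charpoly.roots, z = 0 :=
    Multiset.all_zero_of_le_zero_le_of_sum_eq_zero hroot h0.symm
  have hrad := hsa.spectralRadius_eq_nnnorm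
  have : spectralRadius ℂ (star b * b) = 0 := by
    simp only [spectralRadius, ENNReal.iSup_eq_zero]
    intro z hz
    simp [hzero z ((hspec z).mp hz)]
  rw [this] at hrad
  exact (CStarRing.star_mul_self_eq_zero_iff b).mp (by simpa using hrad.symm)

end RegularTrace
end CStarHopf

end

noncomputable section

namespace CStarHopf

open Coalgebra HopfAlgebra WithConv ComplexOrder

/-! ### The Galois map and convolution idempotence of the trace -/

section GaloisMap

variable {H : Type*} [Ring H] [HopfAlgebra ℂ H]

theorem comul_eq_conv :
    toConv (comul (R := ℂ) (A := H)) =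
      toConv (Algebra.TensorProduct.includeLeft : H →ₐ[ℂ] H ⊗[ℂ] H).toLinearMap *
        toConv (Algebra.TensorProduct.includeRight : H →ₐ[ℂ] H ⊗[ℂ] H).toLinearMap := by
  ext x
  rw [(ℛ ℂ x).convMul_apply]
  simp [(ℛ ℂ x).eq]

variable (H) in
/-- The map `x ⊗ y ↦ Δ(x) (1 ⊗ y)`. -/
def galoisMap : H ⊗[ℂ] H →ₗ[ℂ] H ⊗[ℂ] H :=
  TensorProduct.lift
    ((LinearMap.mul ℂ (H ⊗[ℂ] H)).compl₁₂ comul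
      (Algebra.TensorProduct.includeRight : H →ₐ[ℂ] H ⊗[ℂ] H).toLinearMap)

theorem galoisMap_tmul (x y : H) : galoisMap H (x ⊗ₜ y) = comul x * (1 ⊗ₜ[ℂ] y) := rfl

/-- A preimage of x ⊗ y is x₍₁₎ ⊗ S(x₍₂₎) y. -/
theorem galoisMap_surjective : Function.Surjective (galoisMap H) := by
  intro z
  induction z using TensorProduct.induction_on with
  | zero => exact ⟨0, map_zero _⟩
  | add z w hz hw =>
    obtain ⟨z', rfl⟩ := hz
    obtain ⟨w', rfl⟩ := hw
    exact ⟨z' + w', map_add _ _ _⟩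
  | tmul x y =>
    refine ⟨∑ i ∈ (ℛ ℂ x).index, (ℛ ℂ x).left i ⊗ₜ (antipode ℂ ((ℛ ℂ x).right i) * y), ?_⟩
    have h := congrArg (· * toConv ((Algebra.TensorProduct.includeRight :
      H →ₐ[ℂ] H ⊗[ℂ] H).toLinearMap ∘ₗ antipode ℂ)) (comul_eq_conv (H := H))
    simp only [mul_assoc, conv_algHom_antipode, mul_one] at h
    have h' := congrArg (fun g : WithConv (H →ₗ[ℂ] H ⊗[ℂ] H) => g x * (1 ⊗ₜ[ℂ] y)) h
    simp only [(ℛ ℂ x).convMul_apply] at h'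
    simp only [map_sum, galoisMap_tmul]
    simp [Finset.sum_mul, mul_assoc] at h'
    exact h'

/-- The regular trace is, up to the dimension, idempotent for the convolution. -/
theorem regularTrace_conv [FiniteDimensional ℂ H] (h : H) :
    LinearMap.mul' ℂ ℂ (TensorProduct.map (regularTrace H) (regularTrace H) (comul h))
      = Module.finrank ℂ H * regularTrace H h := by
  have h1 : LinearMap.mul' ℂ ℂ ∘ₗ TensorProduct.map (regularTrace H) (regularTrace H)
      = regularTrace (H ⊗[ℂ] H) := by
    ext x y
    simp only [TensorProduct.AlgebraTensorModule.curry_apply, LinearMap.restrictScalars_self,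
      TensorProduct.curry_apply, LinearMap.comp_apply, TensorProduct.map_tmul,
      LinearMap.mul'_apply, regularTrace_apply]
    rw [← LinearMap.trace_tensorProduct']
    congr 1
    ext
    simp
  let e : (H ⊗[ℂ] H) ≃ₗ[ℂ] (H ⊗[ℂ] H) := LinearEquiv.ofBijective (galoisMap H)
    ⟨LinearMap.injective_iff_surjective.mpr galoisMap_surjective, galoisMap_surjective⟩
  -- Multiplicativity of Δ says that the Galois map conjugates L_h ⊗ id to L_{Δ(h)}; the trace of
  -- the former is tr(L_h) · dim H.
  have h2 : LinearMap.mulLeft ℂ (comul (R := ℂ) h)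
      = e.conj (TensorProduct.map (LinearMap.mulLeft ℂ h) LinearMap.id) := by
    rw [LinearEquiv.conj_apply, LinearEquiv.eq_comp_toLinearMap_symm]
    ext x y
    change comul h * galoisMap H (x ⊗ₜ y) = galoisMap H ((h * x) ⊗ₜ y)
    rw [galoisMap_tmul, galoisMap_tmul, Bialgebra.comul_mul, mul_assoc]
  have := congrArg (fun g => g (comul (R := ℂ) h)) h1
  refine Eq.trans this ?_
  rw [regularTrace_apply, h2, LinearMap.trace_conj', LinearMap.trace_tensorProduct',
    LinearMap.trace_id, regularTrace_apply, mul_comm]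

end GaloisMap

/-! ### The Haar functional and the distinguished projection -/

section Haar

variable {H : Type*} [FinDimCStarHopfAlgebra H]

theorem antipode_injective : Function.Injective (antipode ℂ (A := H)) := by
  have : Function.Surjective (antipode ℂ (A := H)) := fun h =>
    ⟨_, antipode_star_antipode_star h⟩
  exact LinearMap.injective_iff_surjective.mpr this

/-- A faithful positive functional that is idempotent for the convolution is invariant. -/
theorem IsFaithfulPositive.invariant {ω : H →ₗ[ℂ] ℂ} (hω : IsFaithfulPositive ω) (h1 : ω 1 = 1)
    (hidem : ∀ h, LinearMap.mul' ℂ ℂ (TensorProduct.map ω ω (comul h)) = ω h) (h : H) :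
    TensorProduct.rid ℂ H (ω.lTensor H (comul h)) = ω h • 1 := by
  set sl : H ⊗[ℂ] H →ₗ[ℂ] H := (TensorProduct.rid ℂ H).toLinearMap ∘ₗ ω.lTensor H with hsl
  set M : H ⊗[ℂ] H →ₗ[ℂ] ℂ := LinearMap.mul' ℂ ℂ ∘ₗ TensorProduct.map ω ω with hM
  have hsl_tmul (x y : H) : sl (x ⊗ₜ y) = ω y • x := by simp [hsl]
  have hsl_star (z : H ⊗[ℂ] H) : sl (star z) = star (sl z) := by
    induction z using TensorProduct.induction_on with
    | zero => simp
    | tmul x y => simp [hsl_tmul, hω.map_star]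
    | add x y hx hy => simp [hx, hy]
  have hM_right (z : H ⊗[ℂ] H) (b : H) : M (z * (b ⊗ₜ 1)) = ω (sl z * b) := by
    induction z using TensorProduct.induction_on with
    | zero => simp
    | tmul x y => simp [hsl_tmul, hM, mul_comm]
    | add x y hx hy => simp [add_mul, hx, hy]
  have hM_left (z : H ⊗[ℂ] H) (b : H) : M ((b ⊗ₜ 1) * z) = ω (b * sl z) := by
    induction z using TensorProduct.induction_on with
    | zero => simp
    | tmul x y => simp [hsl_tmul, hM, mul_comm]
    | add x y hx hy => simp [mul_add, hx, hy]
  let W : WithConv (H →ₗ[ℂ] H) := toConv (Algebra.linearMap ℂ H ∘ₗ ω)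
  have hWW : W * W = W := by
    ext x
    rw [(ℛ ℂ x).convMul_apply]
    have := hidem x
    rw [← (ℛ ℂ x).eq] at this
    simp only [map_sum, TensorProduct.map_tmul, LinearMap.mul'_apply] at this
    simp [W, ← map_mul, ← map_sum, this]
  have hconv (f : H →ₗ[ℂ] H) (x : H) : (toConv f * W) x = f (sl (comul x)) := by
    rw [(ℛ ℂ x).convMul_apply, ← (ℛ ℂ x).eq]
    simp [W, hsl_tmul, Algebra.algebraMap_eq_smul_one]
  set b : H := sl (comul h) with hb
  -- Slicing by ω is right convolution by ω, so idempotence makes it a projection, and b lies in its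
  -- range.
  have hPb : sl (comul b) = b := by
    have := congrArg (fun g => (toConv (LinearMap.id : H →ₗ[ℂ] H) * g) h) hWW
    simp only [← mul_assoc] at this
    have e1 : toConv (LinearMap.id : H →ₗ[ℂ] H) * W = toConv (sl ∘ₗ comul) := by
      ext x; exact hconv _ x
    rw [e1, hconv] at this
    exact this
  -- For q = Δ(b) - b ⊗ 1, each of the four terms of (ω ⊗ ω)(q*q) is ±ω(b*b), and they cancel. Once
  -- q = 0, applying the counit to the first leg makes b a scalar.
  have hq : comul b - b ⊗ₜ[ℂ] (1 : H) = 0 := by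
    apply hω.tensor_eq_zero
    change M _ = 0
    have hst : star (comul (R := ℂ) b) = comul (star b) :=
      (FinDimCStarHopfAlgebra.comul_star b).symm
    rw [star_sub, sub_mul, mul_sub, mul_sub, TensorProduct.star_tmul, star_one, map_sub,
      map_sub, map_sub, hM_right, hM_left, hM_right, hPb, hsl_star, hPb, hst, ← Bialgebra.comul_mul, hsl_tmul, h1, one_smul]
    have : M (comul (star b * b)) = ω (star b * b) := hidem _
    rw [this]
    ring
  have hbe : b = (counit (R := ℂ) b) • (1 : H) := by
    have := congrArg (fun z => TensorProduct.lid ℂ H ((counit (R := ℂ)).rTensor H z))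
      (sub_eq_zero.mp hq)
    simpa using this
  have hbω : counit (R := ℂ) b = ω h := by
    have h3 : counit (R := ℂ) ∘ₗ sl = ω ∘ₗ (TensorProduct.lid ℂ H).toLinearMap ∘ₗ
        (counit (R := ℂ)).rTensor H := by
      ext x y
      simp [hsl_tmul, mul_comm]
    have := congrArg (fun g => g (comul (R := ℂ) h)) h3
    simpa using this
  change b = _
  rw [hbe, hbω]

variable (H) in
/-- The normalized regular trace. -/
def haarTrace : H →ₗ[ℂ] ℂ := (Module.finrank ℂ H : ℂ)⁻¹ • regularTrace H

theorem nontrivial : Nontrivial H := by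
  refine ⟨1, 0, fun h => ?_⟩
  have := congrArg (counit (R := ℂ)) h
  simp at this

theorem finrank_ne_zero : (Module.finrank ℂ H : ℂ) ≠ 0 := by
  have := nontrivial (H := H)
  exact_mod_cast (Module.finrank_pos (R := ℂ) (M := H)).ne'

theorem haarTrace_isFaithfulPositive : IsFaithfulPositive (haarTrace H) := by
  intro b hb
  have := nontrivial (H := H)
  have h0 : (0 : ℂ) < (Module.finrank ℂ H : ℂ)⁻¹ := by
    rw [inv_pos]
    exact_mod_cast Module.finrank_pos (R := ℂ) (M := H)
  exact mul_pos h0 (regularTrace_isFaithfulPositive H b hb)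

theorem haarTrace_one : haarTrace H 1 = 1 := by
  simp only [haarTrace, LinearMap.smul_apply, regularTrace_apply, LinearMap.mulLeft_one,
    LinearMap.trace_id, smul_eq_mul]
  exact inv_mul_cancel₀ finrank_ne_zero

theorem haarTrace_invariant (h : H) :
    TensorProduct.rid ℂ H ((haarTrace H).lTensor H (comul h)) = haarTrace H h • 1 := by
  refine haarTrace_isFaithfulPositive.invariant haarTrace_one (fun h => ?_) h
  have := regularTrace_conv h
  simp only [haarTrace, TensorProduct.map_smul_left, TensorProduct.map_smul_right,
    LinearMap.smul_apply, map_smul, this, smul_eq_mul]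
  field_simp [finrank_ne_zero (H := H)]

theorem sum_haarTrace_right (h : H) {ι : Type*} (𝓡 : Coalgebra.Repr ℂ h ι) :
    ∑ i ∈ 𝓡.index, haarTrace H (𝓡.right i) • 𝓡.left i = haarTrace H h • 1 := by
  rw [← haarTrace_invariant, ← 𝓡.eq]
  simp

theorem sum_haarTrace_antipode_left (h : H) {ι : Type*} (𝓡 : Coalgebra.Repr ℂ h ι) :
    ∑ i ∈ 𝓡.index, haarTrace H (antipode ℂ (𝓡.left i)) • 𝓡.right i
      = haarTrace H (antipode ℂ h) • 1 := by
  apply antipode_injective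
  have := haarTrace_invariant (antipode ℂ h)
  rw [comul_antipode h 𝓡] at this
  simpa using this

/-- Evaluate ∑ ω(S h₍₁₎) ω(h₍₂₎) twice: left invariance of ω ∘ S gives ω(S h), right invariance of ω
gives ω(h). -/
theorem haarTrace_antipode (h : H) : haarTrace H (antipode ℂ h) = haarTrace H h := by
  have h1 := congrArg (haarTrace H) (sum_haarTrace_antipode_left h (ℛ ℂ h))
  have h2 := congrArg (haarTrace H ∘ₗ antipode ℂ) (sum_haarTrace_right h (ℛ ℂ h))
  simp only [map_sum, map_smul, LinearMap.comp_apply, antipode_one, haarTrace_one, smul_eq_mul,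
    mul_one] at h1 h2
  rw [← h1, ← h2]
  exact Finset.sum_congr rfl fun i _ => mul_comm _ _

theorem sum_haarTrace_left (h : H) {ι : Type*} (𝓡 : Coalgebra.Repr ℂ h ι) :
    ∑ i ∈ 𝓡.index, haarTrace H (𝓡.left i) • 𝓡.right i = haarTrace H h • 1 := by
  simpa only [haarTrace_antipode] using sum_haarTrace_antipode_left h 𝓡

theorem Dual.isDistinguishedProjection_haarTrace :
    Dual.IsDistinguishedProjection ((Dual.toFunctional H).symm (haarTrace H)) := by
  set τ : Dual H := (Dual.toFunctional H).symm (haarTrace H)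
  have happ (h : H) : τ h = haarTrace H h := rfl
  have hl (φ : Dual H) : φ * τ = Dual.counit H φ • τ := by
    ext h
    rw [Dual.mul_apply φ τ (ℛ ℂ h)]
    have := congrArg φ (sum_haarTrace_right h (ℛ ℂ h))
    simp only [map_sum, map_smul] at this
    simp only [happ, mul_comm (φ _)]
    refine Eq.trans this ?_
    exact mul_comm _ _
  have hr (φ : Dual H) : τ * φ = Dual.counit H φ • τ := by
    ext h
    rw [Dual.mul_apply τ φ (ℛ ℂ h)]
    have := congrArg φ (sum_haarTrace_left h (ℛ ℂ h))
    simp only [map_sum, map_smul] at this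
    refine Eq.trans this ?_
    exact mul_comm _ _
  have h1 : Dual.counit H τ = 1 := haarTrace_one
  refine ⟨⟨?_, ?_⟩, ?_, hl, hr⟩
  · exact (hl τ).trans (by rw [h1, one_smul])
  · ext h
    rw [Dual.star_apply, happ, haarTrace_isFaithfulPositive.map_star, star_star,
      haarTrace_antipode, happ]
  · intro h
    rw [h, map_zero] at h1
    exact zero_ne_one h1

theorem Dual.IsDistinguishedProjection.counit_eq_one {τ : Dual H}
    (hτ : τ.IsDistinguishedProjection) : Dual.counit H τ = 1 := by
  have h := (hτ.mul_left τ).symm.trans hτ.isStarProjection.isIdempotentElem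
  by_contra hne
  have : (Dual.counit H τ - 1) • τ = 0 := by rw [sub_smul, h, one_smul, sub_self]
  rcases smul_eq_zero.mp this with h' | h'
  · exact hne (sub_eq_zero.mp h')
  · exact hτ.ne_zero h'

/-- `Dual.tau` is a choice, so it must be pinned down: for two distinguished projections, the
product equals each of them. -/
theorem Dual.toFunctional_tau : Dual.toFunctional H (Dual.tau H) = haarTrace H := by
  have h1 := Dual.isDistinguishedProjection_haarTrace (H := H)
  have h2 : Dual.IsDistinguishedProjection (Dual.tau H) := Classical.epsilon_spec ⟨_, h1⟩
  have h3 := h1.mul_left (Dual.tau H)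
  rw [h2.mul_right, h1.counit_eq_one, h2.counit_eq_one, one_smul, one_smul] at h3
  rw [h3, LinearEquiv.apply_symm_apply]

end Haar

end CStarHopf

end

noncomputable section

namespace CStarHopf

open Coalgebra HopfAlgebra WithConv

/-! ### A ⊗ H⁰ as linear maps H → A under convolution -/

section Slice

variable {A : Type*} [CStarAlgebra A] {H : Type*} [FinDimCStarHopfAlgebra H]

theorem slice_tmul (h : H) (a : A) (φ : Dual H) : slice A h (a ⊗ₜ φ) = φ h • a := by
  simp [slice, Dual.eval]

theorem slice_add (h k : H) (x : A ⊗[ℂ] Dual H) :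
    slice A (h + k) x = slice A h x + slice A k x := by
  induction x using TensorProduct.induction_on with
  | zero => simp
  | add x y hx hy => simp only [map_add, hx, hy]; abel
  | tmul a φ => simp [slice_tmul, add_smul]

theorem slice_smul (c : ℂ) (h : H) (x : A ⊗[ℂ] Dual H) :
    slice A (c • h) x = c • slice A h x := by
  induction x using TensorProduct.induction_on with
  | zero => simp
  | add x y hx hy => simp only [map_add, hx, hy, smul_add]
  | tmul a φ => simp [slice_tmul, smul_smul]

theorem slice_mul (h : H) {ι : Type*} (𝓡 : Coalgebra.Repr ℂ h ι) (x y : A ⊗[ℂ] Dual H) :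
    slice A h (x * y) = ∑ i ∈ 𝓡.index, slice A (𝓡.left i) x * slice A (𝓡.right i) y := by
  induction x using TensorProduct.induction_on with
  | zero => simp
  | add x x' hx hx' => simp [add_mul, hx, hx', Finset.sum_add_distrib]
  | tmul a φ =>
    induction y using TensorProduct.induction_on with
    | zero => simp
    | add y y' hy hy' => simp [mul_add, hy, hy', Finset.sum_add_distrib]
    | tmul b ψ =>
      simp [slice_tmul, Dual.mul_apply φ ψ 𝓡, Finset.sum_smul, smul_smul, mul_comm]

theorem slice_star (h : H) (x : A ⊗[ℂ] Dual H) :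
    slice A h (star x) = star (slice A (star (antipode ℂ h)) x) := by
  induction x using TensorProduct.induction_on with
  | zero => simp
  | add x y hx hy => simp [hx, hy]
  | tmul a φ => simp [slice_tmul, Dual.star_apply]

theorem sum_slice_tmul {ι : Type*} [Fintype ι] (e : Module.Basis ι ℂ H) (x : A ⊗[ℂ] Dual H) :
    ∑ i, slice A (e i) x ⊗ₜ (Dual.toFunctional H).symm (e.coord i) = x := by
  induction x using TensorProduct.induction_on with
  | zero => simp
  | add x y hx hy =>
    simp only [map_add, TensorProduct.add_tmul, Finset.sum_add_distrib, hx, hy]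
  | tmul a φ =>
    simp only [slice_tmul, TensorProduct.smul_tmul, ← TensorProduct.tmul_sum]
    congr 1
    apply (Dual.toFunctional H).injective
    apply e.ext
    intro j
    rw [map_sum, LinearMap.sum_apply, Finset.sum_eq_single j]
    · simp
    · intro i _ hij
      simp [Finsupp.single_eq_of_ne hij]
    · simp

theorem slice_ext {x y : A ⊗[ℂ] Dual H} (h : ∀ k, slice A k x = slice A k y) : x = y := by
  rw [← sum_slice_tmul (Module.finBasis ℂ H) x, ← sum_slice_tmul (Module.finBasis ℂ H) y]
  simp only [h]

theorem exists_slice_eq (X : H →ₗ[ℂ] A) : ∃ x : A ⊗[ℂ] Dual H, ∀ h, slice A h x = X h := by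
  let e := Module.finBasis ℂ H
  refine ⟨∑ i, X (e i) ⊗ₜ (Dual.toFunctional H).symm (e.coord i), fun h => ?_⟩
  have key (i) : (Dual.toFunctional H).symm (e.coord i) h = e.repr h i := rfl
  simp only [map_sum, slice_tmul, key, ← map_smul]
  rw [← map_sum, e.sum_repr]

theorem Dual.map_eval_comul (φ : Dual H) (h k : H) :
    LinearMap.mul' ℂ ℂ (TensorProduct.map (Dual.eval H h) (Dual.eval H k) (Dual.comul H φ))
      = φ (h * k) := by
  have key (z : Dual H ⊗[ℂ] Dual H) :
      LinearMap.mul' ℂ ℂ (TensorProduct.map (Dual.eval H h) (Dual.eval H k) z) =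
        TensorProduct.dualDistribEquiv ℂ H H
          (TensorProduct.congr (Dual.toFunctional H) (Dual.toFunctional H) z) (h ⊗ₜ k) := by
    induction z using TensorProduct.induction_on with
    | zero => simp
    | add x y hx hy => simp only [map_add, hx, hy, LinearMap.add_apply]
    | tmul φ ψ => simp [Dual.eval, TensorProduct.dualDistribEquiv]
  simp only [key, Dual.comul, LinearMap.comp_apply, LinearEquiv.coe_coe,
    ← TensorProduct.congr_symm, LinearEquiv.apply_symm_apply]
  rfl

end Slice

/-! ### The module algebra structure induced by a coaction -/

namespace Coaction

variable {A : Type*} [CStarAlgebra A] {H : Type*} [FinDimCStarHopfAlgebra H] (ρ : Coaction A H)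

/-- Nondegeneracy enters here: ρ(1) is a left unit on ρ(A)(A ⊗ H⁰), and {x | ρ(1)x = x} is closed
because its defining equations are continuous in the slices of x. -/
theorem map_one : ρ 1 = 1 := by
  have hclosed : ∀ x : A ⊗[ℂ] Dual H, ρ 1 * x = x := by
    let T := tensorTopology A H
    have hS : IsClosed {x : A ⊗[ℂ] Dual H | ρ 1 * x = x} := by
      have hcont (h : H) : Continuous (fun x : A ⊗[ℂ] Dual H => slice A h x) :=
        (continuous_apply (A := fun _ : H => A) h).comp
          (continuous_induced_dom (f := fun (x : A ⊗[ℂ] Dual H) (h : H) => slice A h x))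
      have hset : {x : A ⊗[ℂ] Dual H | ρ 1 * x = x} = ⋂ h : H, {x | ∑ i ∈ (ℛ ℂ h).index,
          slice A ((ℛ ℂ h).left i) (ρ 1) * slice A ((ℛ ℂ h).right i) x = slice A h x} := by
        ext x
        simp only [Set.mem_ofPred_eq, Set.mem_iInter, ← slice_mul]
        exact ⟨fun h k => by rw [h], slice_ext⟩
      rw [hset]
      exact isClosed_iInter fun h => isClosed_eq
        (continuous_finsetSum _ fun i _ => continuous_const.mul (hcont _)) (hcont h)
    have hsub : (Submodule.span ℂ {z : A ⊗[ℂ] Dual H | ∃ a x, z = ρ a * x} :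
        Set (A ⊗[ℂ] Dual H)) ⊆ {x | ρ 1 * x = x} := by
      intro z hz
      induction hz using Submodule.span_induction with
      | mem z hz =>
        obtain ⟨a, x, rfl⟩ := hz
        change ρ 1 * (ρ a * x) = ρ a * x
        rw [← mul_assoc, ← map_mul, one_mul]
      | zero => exact mul_zero _
      | add x y _ _ hx hy => exact (mul_add _ _ _).trans (congrArg₂ _ hx hy)
      | smul c x _ hx => exact (mul_smul_comm _ _ _).trans (congrArg _ hx)
    have := hS.closure_subset_iff.mpr hsub
    intro x
    exact this (ρ.nondegenerate ▸ Set.mem_univ x)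
  simpa using hclosed 1

theorem act_one (h : H) : ρ.act h 1 = counit (R := ℂ) h • 1 := by
  rw [act_apply, map_one, Algebra.TensorProduct.one_def, slice_tmul, Dual.one_apply]

theorem one_act (a : A) : ρ.act 1 a = a := ρ.counit_comp a

theorem act_mul (h : H) {ι : Type*} (𝓡 : Coalgebra.Repr ℂ h ι) (a b : A) :
    ρ.act h (a * b) = ∑ i ∈ 𝓡.index, ρ.act (𝓡.left i) a * ρ.act (𝓡.right i) b := by
  simp only [act_apply, map_mul, slice_mul h 𝓡]

theorem act_star (h : H) (a : A) :
    ρ.act h (star a) = star (ρ.act (star (antipode ℂ h)) a) := by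
  simp only [act_apply, map_star, slice_star]

theorem mul_act (h k : H) (a : A) : ρ.act (h * k) a = ρ.act h (ρ.act k a) := by
  -- `T` evaluates the two H⁰ legs at h and k; the claim is `T` applied to both sides of
  -- coassociativity.
  let T : A ⊗[ℂ] (Dual H ⊗[ℂ] Dual H) →ₗ[ℂ] A := (TensorProduct.rid ℂ A).toLinearMap ∘ₗ
    (LinearMap.mul' ℂ ℂ ∘ₗ TensorProduct.map (Dual.eval H h) (Dual.eval H k)).lTensor A
  have h1 (x : A ⊗[ℂ] Dual H) : T ((Dual.comul H).lTensor A x) = slice A (h * k) x := by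
    induction x using TensorProduct.induction_on with
    | zero => simp
    | add x y hx hy => simp only [map_add, hx, hy]
    | tmul a φ => simp [T, slice_tmul, Dual.map_eval_comul]
  have h2 (x : A ⊗[ℂ] Dual H) :
      T (TensorProduct.assoc ℂ A (Dual H) (Dual H) (ρ.linear.rTensor (Dual H) x)) =
        ρ.act h (slice A k x) := by
    induction x using TensorProduct.induction_on with
    | zero => simp
    | add x y hx hy => simp only [map_add, hx, hy]
    | tmul a φ =>
      have h3 (y : A ⊗[ℂ] Dual H) :
          T (TensorProduct.assoc ℂ A (Dual H) (Dual H) (y ⊗ₜ φ)) = φ k • slice A h y := by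
        induction y using TensorProduct.induction_on with
        | zero => simp
        | add x y hx hy => simp only [map_add, TensorProduct.add_tmul, smul_add, hx, hy]
        | tmul b ψ => simp [T, slice_tmul, Dual.eval, smul_smul, mul_comm]
      rw [LinearMap.rTensor_tmul, h3, slice_tmul, map_smul]
      rfl
  rw [act_apply, ← h1]
  exact (congrArg T (ρ.coassoc a)).symm.trans (h2 _)

/-- The action of `H` on `A` as an algebra homomorphism. -/
def actAlgHom : H →ₐ[ℂ] Module.End ℂ A :=
  AlgHom.ofLinearMap ρ.act (LinearMap.ext ρ.one_act) fun h k => LinearMap.ext (ρ.mul_act h k)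

theorem twist_tmul_mul (h : H) {ι : Type*} (𝓡 : Coalgebra.Repr ℂ h ι) (a b : A) :
    ρ.twist (h ⊗ₜ (a * b)) =
      ∑ i ∈ 𝓡.index, (ρ.act (𝓡.left i) a ⊗ₜ[ℂ] 1) * ρ.twist (𝓡.right i ⊗ₜ b) := by
  let β (a : A) : WithConv (H →ₗ[ℂ] A ⊗[ℂ] H) := toConv
    ((Algebra.TensorProduct.includeLeft : A →ₐ[ℂ] A ⊗[ℂ] H).toLinearMap ∘ₗ ρ.act.flip a)
  let j : WithConv (H →ₗ[ℂ] A ⊗[ℂ] H) :=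
    toConv (Algebra.TensorProduct.includeRight : H →ₐ[ℂ] A ⊗[ℂ] H).toLinearMap
  have h1 (b : A) (k : H) : ρ.twist (k ⊗ₜ b) = (β b * j) k := by
    rw [ρ.twist_tmul (ℛ ℂ k), (ℛ ℂ k).convMul_apply]
    simp [β, j]
  have h2 : β (a * b) = β a * β b := by
    ext k
    rw [(ℛ ℂ k).convMul_apply]
    simp [β, ρ.act_mul k (ℛ ℂ k)]
  rw [h1, h2, mul_assoc, 𝓡.convMul_apply]
  simp only [h1]
  simp [β]

end Coaction

/-! ### The crossed product as an algebra -/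

namespace CrossedProduct

variable {A : Type*} [CStarAlgebra A] {H : Type*} [FinDimCStarHopfAlgebra H] (ρ : Coaction A H)

/-- The diagonal action of `H` on `A ⊗ H`. -/
def diagonal : H →ₐ[ℂ] Module.End ℂ (A ⊗[ℂ] H) :=
  (Module.endTensorEndAlgHom.comp (Algebra.TensorProduct.map ρ.actAlgHom (Algebra.lmul ℂ H))).comp
    (Bialgebra.comulAlgHom ℂ H)

theorem diagonal_tmul (h : H) (b : A) (l : H) :
    diagonal ρ h (b ⊗ₜ l) = ρ.twist (h ⊗ₜ b) * (1 ⊗ₜ l) := by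
  rw [ρ.twist_tmul (ℛ ℂ h)]
  simp only [diagonal, AlgHom.comp_apply, Bialgebra.comulAlgHom_apply]
  rw [← (ℛ ℂ h).eq]
  simp only [map_sum, LinearMap.sum_apply, Finset.sum_mul, Algebra.TensorProduct.map_tmul,
    Algebra.TensorProduct.tmul_mul_tmul, mul_one]
  rfl

theorem mulMap_tmul (a : A) (h : H) :
    mulMap ρ (a ⊗ₜ h) = LinearMap.mulLeft ℂ (a ⊗ₜ[ℂ] (1 : H)) * diagonal ρ h := by
  ext b l
  simp [mulMap, diagonal_tmul, mul_assoc]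

theorem diagonal_mul_mulLeft (h : H) {ι : Type*} (𝓡 : Coalgebra.Repr ℂ h ι) (a : A) :
    diagonal ρ h * LinearMap.mulLeft ℂ (a ⊗ₜ[ℂ] (1 : H)) =
      ∑ i ∈ 𝓡.index, LinearMap.mulLeft ℂ (ρ.act (𝓡.left i) a ⊗ₜ[ℂ] (1 : H)) *
        diagonal ρ (𝓡.right i) := by
  ext b l
  simp [diagonal_tmul, ρ.twist_tmul_mul h 𝓡, Finset.sum_mul, mul_assoc]

/-- Associativity, stated for left multiplication operators. These are L_{a ⊗ 1} composed with the
diagonal action, a homomorphism because Δ is one, so only the commutation of h past b has to be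
checked. -/
theorem mulMap_mulMap (x y : A ⊗[ℂ] H) :
    mulMap ρ (mulMap ρ x y) = mulMap ρ x * mulMap ρ y := by
  induction x using TensorProduct.induction_on with
  | zero => simp
  | add x x' hx hx' => simp only [map_add, LinearMap.add_apply, hx, hx', add_mul]
  | tmul a h =>
    induction y using TensorProduct.induction_on with
    | zero => simp
    | add y y' hy hy' => simp only [map_add, hy, hy', mul_add]
    | tmul b l =>
      have h1 : mulMap ρ (a ⊗ₜ h) (b ⊗ₜ l) = ∑ i ∈ (ℛ ℂ h).index,
          (a * ρ.act ((ℛ ℂ h).left i) b) ⊗ₜ[ℂ] ((ℛ ℂ h).right i * l) :=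
        of_mul_of ρ a b h l (ℛ ℂ h)
      have h2 (c d : A) : LinearMap.mulLeft ℂ ((c * d) ⊗ₜ[ℂ] (1 : H)) =
          LinearMap.mulLeft ℂ (c ⊗ₜ[ℂ] (1 : H)) * LinearMap.mulLeft ℂ (d ⊗ₜ[ℂ] (1 : H)) := by
        ext
        simp [mul_assoc]
      rw [h1, mulMap_tmul, mulMap_tmul, mul_assoc, ← mul_assoc (diagonal ρ h),
        diagonal_mul_mulLeft ρ h (ℛ ℂ h)]
      simp only [map_sum, mulMap_tmul, map_mul, h2, Finset.sum_mul, Finset.mul_sum, mul_assoc]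

scoped instance : One (CrossedProduct ρ) := ⟨of ρ 1 1⟩

theorem induction_on {p : CrossedProduct ρ → Prop} (x : CrossedProduct ρ)
    (zero : p 0) (of : ∀ a h, p (of ρ a h)) (add : ∀ x y, p x → p y → p (x + y)) : p x :=
  TensorProduct.induction_on x zero of add

theorem of_one_mul_of (a b : A) (l : H) : of ρ a 1 * of ρ b l = of ρ (a * b) l := by
  change mulMap ρ (a ⊗ₜ 1) (b ⊗ₜ l) = (a * b) ⊗ₜ l
  simp [mulMap_tmul]

theorem of_mul_of_one (a : A) (h l : H) : of ρ a h * of ρ 1 l = of ρ a (h * l) := by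
  rw [of_mul_of ρ a 1 h l (ℛ ℂ h)]
  change ∑ i ∈ (ℛ ℂ h).index,
    (a * ρ.act ((ℛ ℂ h).left i) 1) ⊗ₜ[ℂ] ((ℛ ℂ h).right i * l) = a ⊗ₜ (h * l)
  simp only [ρ.act_one, mul_smul_comm, mul_one, TensorProduct.smul_tmul, ← smul_mul_assoc]
  rw [← TensorProduct.tmul_sum, ← Finset.sum_mul, sum_counit_smul]

scoped instance : Ring (CrossedProduct ρ) where
  left_distrib x y z := map_add (mulMap ρ x) y z
  right_distrib x y z := LinearMap.congr_fun (map_add (mulMap ρ) x y) z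
  zero_mul x := LinearMap.congr_fun (map_zero (mulMap ρ)) x
  mul_zero x := map_zero (mulMap ρ x)
  mul_assoc x y z := LinearMap.congr_fun (mulMap_mulMap ρ x y) z
  one_mul x := by
    change mulMap ρ (1 ⊗ₜ 1) x = x
    rw [mulMap_tmul, map_one, ← Algebra.TensorProduct.one_def, LinearMap.mulLeft_one]
    rfl
  mul_one x := by
    have h : (mulMap ρ).flip (1 ⊗ₜ 1) = LinearMap.id := by
      ext a h
      exact (of_mul_of_one ρ a h 1).trans (by rw [mul_one]; rfl)
    exact LinearMap.congr_fun h x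
  -- Multiples are those of the existing additive group, so the two structures agree definitionally.
  zsmul := (· • ·)
  zsmul_zero' := SubNegMonoid.zsmul_zero'
  zsmul_succ' := SubNegMonoid.zsmul_succ'
  zsmul_neg' := SubNegMonoid.zsmul_neg'
  nsmul := (· • ·)
  nsmul_zero := AddMonoid.nsmul_zero
  nsmul_succ := AddMonoid.nsmul_succ
  neg_add_cancel := neg_add_cancel
  sub_eq_add_neg := sub_eq_add_neg

scoped instance : Algebra ℂ (CrossedProduct ρ) :=
  Algebra.ofModule (fun c x y => LinearMap.congr_fun (map_smul (mulMap ρ) c x) y)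
    (fun c x y => map_smul (mulMap ρ x) c y)

/-- The embedding `a ↦ a ⋊ 1`. -/
def ofLeft : A →ₐ[ℂ] CrossedProduct ρ :=
  AlgHom.ofLinearMap ((TensorProduct.mk ℂ A H).flip 1) rfl
    fun a b => (of_one_mul_of ρ a b 1).symm

/-- The embedding `h ↦ 1 ⋊ h`. -/
def ofRight : H →ₐ[ℂ] CrossedProduct ρ :=
  AlgHom.ofLinearMap (TensorProduct.mk ℂ A H 1) rfl
    fun h l => (of_mul_of_one ρ 1 h l).symm

theorem ofLeft_apply (a : A) : ofLeft ρ a = of ρ a 1 := rfl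

theorem ofRight_apply (h : H) : ofRight ρ h = of ρ 1 h := rfl

theorem of_eq (a : A) (h : H) : of ρ a h = ofLeft ρ a * ofRight ρ h := by
  rw [ofLeft_apply, ofRight_apply, of_one_mul_of, mul_one]

theorem ofRight_mul_ofLeft (h : H) {ι : Type*} (𝓡 : Coalgebra.Repr ℂ h ι) (a : A) :
    ofRight ρ h * ofLeft ρ a =
      ∑ i ∈ 𝓡.index, ofLeft ρ (ρ.act (𝓡.left i) a) * ofRight ρ (𝓡.right i) := by
  rw [ofRight_apply, ofLeft_apply, of_mul_of ρ 1 a h 1 𝓡]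
  simp only [one_mul, mul_one, of_eq]

end CrossedProduct

end CStarHopf

end

noncomputable section

namespace CStarHopf

open Coalgebra HopfAlgebra WithConv ComplexOrder

theorem IsFaithfulPositive.sum_smul_basis {B : Type*} [Ring B] [StarRing B] [Algebra ℂ B]
    {ω : B →ₗ[ℂ] ℂ} {ι : Type*} [Fintype ι] [DecidableEq ι] {e : Module.Basis ι ℂ B}
    (he : ∀ i j, ω (star (e i) * e j) = if i = j then 1 else 0) (b : B) :
    ∑ i, ω (star (e i) * b) • e i = b := by
  conv_rhs => rw [← e.sum_repr b]
  refine Finset.sum_congr rfl fun i _ => ?_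
  congr 1
  have h : ω ∘ₗ LinearMap.mulLeft ℂ (star (e i)) = e.coord i :=
    e.ext fun j => by simp [he, Finsupp.single_apply, eq_comm]
  exact LinearMap.congr_fun h b

/-! ### Sums and bounds of squares in a C*-algebra -/

section CStar

variable {A : Type*} [CStarAlgebra A]

theorem exists_add_star_mul_self (a b : A) : ∃ c : A, star a * a + star b * b = star c * c := by
  let _ := CStarAlgebra.spectralOrder A
  have _ := CStarAlgebra.spectralOrderedRing A
  exact CStarAlgebra.nonneg_iff_eq_star_mul_self.mp
    (add_nonneg (star_mul_self_nonneg a) (star_mul_self_nonneg b))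

theorem exists_sum_star_mul_self {ι : Type*} (s : Finset ι) (a : ι → A) :
    ∃ c : A, ∑ i ∈ s, star (a i) * a i = star c * c := by
  induction s using Finset.cons_induction with
  | empty => exact ⟨0, by simp⟩
  | cons i s hi ih =>
    obtain ⟨c, hc⟩ := ih
    rw [Finset.sum_cons, hc]
    exact exists_add_star_mul_self _ _

theorem exists_one_sub_smul_star_mul_self (a : A) :
    ∃ t : ℝ, 0 < t ∧ ∃ w : A, 1 - ((t ^ 2 : ℝ) : ℂ) • (star a * a) = star w * w := by
  let _ := CStarAlgebra.spectralOrder A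
  have _ := CStarAlgebra.spectralOrderedRing A
  refine ⟨(‖a‖ + 1)⁻¹, by positivity, CStarAlgebra.nonneg_iff_eq_star_mul_self.mp ?_⟩
  set t : ℝ := (‖a‖ + 1)⁻¹ with ht
  have hnorm : ‖(t : ℂ) • a‖ ≤ 1 := by
    rw [norm_smul, Complex.norm_real, ht, norm_inv, Real.norm_of_nonneg (by positivity),
      inv_mul_le_one₀ (by positivity)]
    linarith
  have hle := CStarAlgebra.star_mul_le_algebraMap_norm_sq (a := (t : ℂ) • a)
  have hone : algebraMap ℝ A (‖(t : ℂ) • a‖ ^ 2) ≤ 1 := by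
    rw [← map_one (algebraMap ℝ A)]
    exact algebraMap_mono A (pow_le_one₀ (norm_nonneg _) hnorm)
  rw [sub_nonneg]
  refine le_trans (le_of_eq ?_) (hle.trans hone)
  rw [star_smul, smul_mul_smul_comm]
  congr 1
  simp [pow_two]

end CStar

/-! ### The involution and the canonical expectation -/

namespace CrossedProduct

variable {A : Type*} [CStarAlgebra A] {H : Type*} [FinDimCStarHopfAlgebra H] (ρ : Coaction A H)

theorem star_ofLeft_mul_ofRight (a : A) (h : H) :
    star (ofLeft ρ a * ofRight ρ h) = ofRight ρ (star h) * ofLeft ρ (star a) := by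
  rw [← of_eq, ofRight_mul_ofLeft ρ (star h) (ℛ ℂ (star h))]
  change ρ.twist (star h ⊗ₜ star a) = _
  rw [ρ.twist_tmul (ℛ ℂ (star h))]
  simp only [← of_eq]
  rfl

/-- The covariance relation V(h)a = ∑ (h₍₁₎·a)V(h₍₂₎), read in the convolution algebra as Vκ = αV,
is multiplied on both sides by the inverse V ∘ S of V. -/
theorem ofLeft_mul_ofRight_antipode (h : H) {ι : Type*} (𝓡 : Coalgebra.Repr ℂ h ι) (a : A) :
    ofLeft ρ a * ofRight ρ (antipode ℂ h) = ∑ i ∈ 𝓡.index,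
      ofRight ρ (antipode ℂ (𝓡.left i)) * ofLeft ρ (ρ.act (𝓡.right i) a) := by
  let V : WithConv (H →ₗ[ℂ] CrossedProduct ρ) := toConv (ofRight ρ).toLinearMap
  let V' : WithConv (H →ₗ[ℂ] CrossedProduct ρ) :=
    toConv ((ofRight ρ).toLinearMap ∘ₗ antipode ℂ)
  let α : WithConv (H →ₗ[ℂ] CrossedProduct ρ) :=
    toConv ((ofLeft ρ).toLinearMap ∘ₗ ρ.act.flip a)
  let κ : WithConv (H →ₗ[ℂ] CrossedProduct ρ) := toConv ((counit (R := ℂ)).smulRight (ofLeft ρ a))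
  have h1 : V * κ = α * V := by
    ext k
    rw [(ℛ ℂ k).convMul_apply, (ℛ ℂ k).convMul_apply]
    have h2 : ∑ i ∈ (ℛ ℂ k).index, counit (R := ℂ) ((ℛ ℂ k).right i) • (ℛ ℂ k).left i = k := by
      have := congrArg (TensorProduct.rid ℂ H) (lTensor_counit_comul (R := ℂ) k)
      simpa only [← (ℛ ℂ k).eq, map_sum, LinearMap.lTensor_tmul, TensorProduct.rid_tmul,
        one_smul] using this
    have h3 := ofRight_mul_ofLeft ρ k (ℛ ℂ k) a
    refine Eq.trans ?_ h3
    conv_rhs => rw [← h2]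
    simp [V, κ, Finset.sum_mul]
  have h4 : κ * V' = V' * α := by
    have e1 : V' * V = 1 := conv_antipode_algHom (ofRight ρ)
    have e2 : V * V' = 1 := conv_algHom_antipode (ofRight ρ)
    calc κ * V' = V' * V * κ * V' := by rw [e1, one_mul]
      _ = V' * (V * κ) * V' := by simp only [mul_assoc]
      _ = V' * α * (V * V') := by rw [h1]; simp only [mul_assoc]
      _ = V' * α := by rw [e2, mul_one]
  have h5 := congrArg (fun g : WithConv (H →ₗ[ℂ] CrossedProduct ρ) => g h) h4
  simp only [𝓡.convMul_apply] at h5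
  refine Eq.trans ?_ h5
  conv_lhs => rw [← sum_counit_smul (R := ℂ) 𝓡]
  simp [κ, V', Finset.mul_sum]

theorem star_ofRight_mul_ofLeft (a : A) (h : H) :
    star (ofRight ρ h * ofLeft ρ a) = ofLeft ρ (star a) * ofRight ρ (star h) := by
  set m : H := star (antipode ℂ h)
  have hm : antipode ℂ m = star h := by simpa using antipode_star_antipode_star (star h)
  have hm' : star (antipode ℂ m) = h := by rw [hm, star_star]
  let 𝓡 := ℛ ℂ m
  -- Since h = S(m)*, a decomposition of Δ(m) yields one of Δ(h) whose terms match the formula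
  -- moving a past V(S m).
  let 𝓡' : Coalgebra.Repr ℂ h (H × H) :=
    { index := 𝓡.index
      left := fun i => star (antipode ℂ (𝓡.right i))
      right := fun i => star (antipode ℂ (𝓡.left i))
      eq := by
        rw [← hm', FinDimCStarHopfAlgebra.comul_star, comul_antipode m 𝓡]
        simp }
  have hsum (s : Finset (H × H)) (f : H × H → CrossedProduct ρ) :
      star (∑ i ∈ s, f i) = ∑ i ∈ s, star (f i) := by
    change (ρ.twist ∘ₗ (TensorProduct.comm ℂ A H).toLinearMap)
      (star (∑ i ∈ s, (show A ⊗[ℂ] H from f i))) = _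
    rw [star_sum, map_sum]
    rfl
  rw [ofRight_mul_ofLeft ρ h 𝓡' a, hsum, ← hm, ofLeft_mul_ofRight_antipode ρ m 𝓡]
  refine Finset.sum_congr rfl fun i _ => ?_
  rw [star_ofLeft_mul_ofRight, ρ.act_star]
  simp [𝓡']

theorem star_add' (x y : CrossedProduct ρ) : star (x + y) = star x + star y :=
  (congrArg (ρ.twist ∘ₗ (TensorProduct.comm ℂ A H).toLinearMap)
    (star_add (R := A ⊗[ℂ] H) x y)).trans (map_add _ _ _)

theorem star_zero' : star (0 : CrossedProduct ρ) = 0 :=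
  (congrArg (ρ.twist ∘ₗ (TensorProduct.comm ℂ A H).toLinearMap)
    (star_zero (A ⊗[ℂ] H))).trans (map_zero _)

theorem star_ofLeft_mul (a : A) (x : CrossedProduct ρ) :
    star (ofLeft ρ a * x) = star x * ofLeft ρ (star a) := by
  induction x using induction_on with
  | zero => simp [star_zero']
  | add x y hx hy => rw [mul_add, star_add', star_add', hx, hy, add_mul]
  | of b h =>
    rw [of_eq, ← mul_assoc, ← map_mul, star_ofLeft_mul_ofRight, star_ofLeft_mul_ofRight, star_mul,
      map_mul, mul_assoc]

theorem star_mul_ofRight (x : CrossedProduct ρ) (h : H) :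
    star (x * ofRight ρ h) = ofRight ρ (star h) * star x := by
  induction x using induction_on with
  | zero => simp [star_zero']
  | add x y hx hy => rw [add_mul, star_add', star_add', hx, hy, mul_add]
  | of b k =>
    rw [of_eq, mul_assoc, ← map_mul, star_ofLeft_mul_ofRight, star_ofLeft_mul_ofRight, star_mul,
      map_mul, mul_assoc]

scoped instance : StarAddMonoid (CrossedProduct ρ) where
  star_involutive x := by
    induction x using induction_on with
    | zero => rw [star_zero', star_zero']
    | add x y hx hy => rw [star_add', star_add', hx, hy]
    | of a h => rw [of_eq, star_ofLeft_mul_ofRight, star_ofRight_mul_ofLeft, star_star, star_star]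
  star_add := star_add' ρ

scoped instance : StarRing (CrossedProduct ρ) where
  star_mul x y := by
    induction x using induction_on with
    | zero => simp
    | add x x' hx hx' => rw [add_mul, star_add, star_add, hx, hx', mul_add]
    | of a h =>
      rw [of_eq, mul_assoc, star_ofLeft_mul, star_ofLeft_mul_ofRight, ← mul_assoc]
      congr 1
      induction y using induction_on with
      | zero => simp
      | add y y' hy hy' => rw [mul_add, star_add, star_add, hy, hy', add_mul]
      | of b k =>
        rw [of_eq, ← mul_assoc, star_mul_ofRight, star_ofRight_mul_ofLeft,
          star_ofLeft_mul_ofRight, mul_assoc]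
  star_add := star_add

scoped instance : StarModule ℂ (CrossedProduct ρ) where
  star_smul c x := (congrArg (ρ.twist ∘ₗ (TensorProduct.comm ℂ A H).toLinearMap)
    (star_smul (A := A ⊗[ℂ] H) c x)).trans (map_smul _ _ _)

theorem star_ofLeft (a : A) : star (ofLeft ρ a) = ofLeft ρ (star a) := by
  simpa using star_ofLeft_mul_ofRight ρ a 1

-- The involution exchanges the forms aV(h) and V(h)a, so the latter span as well.
@[elab_as_elim]
theorem induction_on_ofRight_mul_ofLeft {p : CrossedProduct ρ → Prop} (x : CrossedProduct ρ)
    (zero : p 0) (mul : ∀ h a, p (ofRight ρ h * ofLeft ρ a))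
    (add : ∀ x y, p x → p y → p (x + y)) : p x := by
  rw [← star_star x]
  induction star x using induction_on with
  | zero => simpa using zero
  | of a h =>
    rw [of_eq, star_ofLeft_mul_ofRight]
    exact mul _ _
  | add x y hx hy =>
    rw [star_add]
    exact add _ _ hx hy

local notation "𝓔" => canonicalCondExp

theorem canonicalCondExp_ofLeft_mul_ofRight (a : A) (h : H) :
    𝓔 ρ (ofLeft ρ a * ofRight ρ h) = haarTrace H h • a := by
  rw [← of_eq, canonicalCondExp_of, ← Dual.toFunctional_apply, Dual.toFunctional_tau]

theorem canonicalCondExp_ofRight (h : H) : 𝓔 ρ (ofRight ρ h) = haarTrace H h • 1 := by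
  simpa using canonicalCondExp_ofLeft_mul_ofRight ρ 1 h

theorem canonicalCondExp_ofLeft (a : A) : 𝓔 ρ (ofLeft ρ a) = a := by
  simpa [haarTrace_one] using canonicalCondExp_ofLeft_mul_ofRight ρ a 1

theorem ofLeft_injective : Function.Injective (ofLeft ρ) :=
  Function.LeftInverse.injective (canonicalCondExp_ofLeft ρ)

theorem canonicalCondExp_ofLeft_mul (a : A) (x : CrossedProduct ρ) :
    𝓔 ρ (ofLeft ρ a * x) = a * 𝓔 ρ x := by
  induction x using induction_on with
  | zero => simp
  | add x y hx hy => simp only [mul_add, map_add, hx, hy]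
  | of b h =>
    rw [of_eq, ← mul_assoc, ← map_mul, canonicalCondExp_ofLeft_mul_ofRight,
      canonicalCondExp_ofLeft_mul_ofRight, mul_smul_comm]

/-- Right linearity is invariance of ω: E(V(h)a) = (∑ ω(h₍₂₎) h₍₁₎)·a = ω(h)a. -/
theorem canonicalCondExp_mul_ofLeft (x : CrossedProduct ρ) (a : A) :
    𝓔 ρ (x * ofLeft ρ a) = 𝓔 ρ x * a := by
  induction x using induction_on with
  | zero => simp
  | add x y hx hy => simp only [add_mul, map_add, hx, hy]
  | of b h =>
    rw [of_eq, mul_assoc, canonicalCondExp_ofLeft_mul, canonicalCondExp_ofLeft_mul, mul_assoc,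
      ofRight_mul_ofLeft ρ h (ℛ ℂ h), map_sum, canonicalCondExp_ofRight]
    simp only [canonicalCondExp_ofLeft_mul_ofRight]
    have := congrArg (fun k => ρ.act k a) (sum_haarTrace_right h (ℛ ℂ h))
    simp only [map_sum, map_smul, LinearMap.sum_apply, LinearMap.smul_apply, ρ.one_act] at this
    rw [this, smul_mul_assoc, one_mul]

theorem sum_canonicalCondExp_mul {ι : Type*} [Fintype ι] [DecidableEq ι] {e : Module.Basis ι ℂ H}
    (he : ∀ i j, haarTrace H (star (e i) * e j) = if i = j then 1 else 0) (y : CrossedProduct ρ) :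
    ∑ i, ofLeft ρ (𝓔 ρ (y * ofRight ρ (e i))) * ofRight ρ (star (e i)) = y := by
  induction y using induction_on with
  | zero => simp
  | add x y hx hy =>
    simp only [add_mul, map_add, Finset.sum_add_distrib, hx, hy]
  | of a h =>
    have := congrArg star (IsFaithfulPositive.sum_smul_basis he (star h))
    simp only [star_sum, star_smul, star_star, ← haarTrace_isFaithfulPositive.map_star,
      star_mul] at this
    conv_rhs => rw [of_eq, ← this, map_sum, Finset.mul_sum]
    refine Finset.sum_congr rfl fun i _ => ?_
    rw [of_eq, mul_assoc, ← map_mul, canonicalCondExp_ofLeft_mul_ofRight, map_smul, map_smul,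
      smul_mul_assoc, mul_smul_comm]

theorem ext_canonicalCondExp {x y : CrossedProduct ρ}
    (h : ∀ k, 𝓔 ρ (x * ofRight ρ k) = 𝓔 ρ (y * ofRight ρ k)) : x = y := by
  obtain ⟨e, he⟩ := (haarTrace_isFaithfulPositive (H := H)).exists_orthonormal_basis
  rw [← sum_canonicalCondExp_mul ρ he x, ← sum_canonicalCondExp_mul ρ he y]
  simp only [h]

theorem exists_canonicalCondExp_mul_eq (X : H →ₗ[ℂ] A) :
    ∃ y : CrossedProduct ρ, ∀ k, 𝓔 ρ (y * ofRight ρ k) = X k := by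
  obtain ⟨e, he⟩ := (haarTrace_isFaithfulPositive (H := H)).exists_orthonormal_basis
  refine ⟨∑ i, ofLeft ρ (X (e i)) * ofRight ρ (star (e i)), fun k => ?_⟩
  simp only [Finset.sum_mul, mul_assoc, ← map_mul, map_sum, canonicalCondExp_ofLeft_mul_ofRight]
  simp only [← map_smul]
  rw [← map_sum, IsFaithfulPositive.sum_smul_basis he]

theorem canonicalCondExp_isCondExp : IsCondExp (𝓔 ρ) where
  apply_of := canonicalCondExp_ofLeft ρ
  mul_left := canonicalCondExp_ofLeft_mul ρ
  mul_right := canonicalCondExp_mul_ofLeft ρ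
  positive x := by
    obtain ⟨e, he⟩ := (haarTrace_isFaithfulPositive (H := H)).exists_orthonormal_basis
    set b := fun i => star (𝓔 ρ (star x * ofRight ρ (e i))) with hb
    have hx : star x = ∑ i, ofLeft ρ (star (b i)) * ofRight ρ (star (e i)) := by
      simp only [hb, star_star]
      exact (sum_canonicalCondExp_mul ρ he (star x)).symm
    -- In the form x = ∑ V(e_i) b_i, orthonormality leaves E(x*x) = ∑ b_i* b_i.
    have hx' : x = ∑ i, ofRight ρ (e i) * ofLeft ρ (b i) := by
      rw [← star_star x, hx, star_sum]
      simp only [star_ofLeft_mul_ofRight, star_star]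
    obtain ⟨c, hc⟩ := exists_sum_star_mul_self Finset.univ b
    refine ⟨c, hc ▸ ?_⟩
    rw [hx]
    conv_lhs => rw [hx']
    have key (i j) : 𝓔 ρ (ofLeft ρ (star (b i)) * ofRight ρ (star (e i)) *
        (ofRight ρ (e j) * ofLeft ρ (b j))) = if i = j then star (b i) * b j else 0 := by
      rw [← mul_assoc, canonicalCondExp_mul_ofLeft, mul_assoc, ← map_mul,
        canonicalCondExp_ofLeft_mul_ofRight, he]
      split_ifs <;> simp
    simp only [Finset.sum_mul, Finset.mul_sum, map_sum, key]
    simp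

/-- Every right `A`-module map `A ⋊ H → A` is represented by an element of `A ⋊ H`. -/
theorem exists_eq_canonicalCondExp_mul {F : CrossedProduct ρ →ₗ[ℂ] A}
    (hF : ∀ x a, F (x * ofLeft ρ a) = F x * a) :
    ∃ y : CrossedProduct ρ, ∀ x, F x = 𝓔 ρ (y * x) := by
  obtain ⟨y, hy⟩ := exists_canonicalCondExp_mul_eq ρ (F ∘ₗ (ofRight ρ).toLinearMap)
  refine ⟨y, fun x => ?_⟩
  induction x using induction_on_ofRight_mul_ofLeft with
  | zero => simp
  | add x x' hx hx' => simp only [mul_add, map_add, hx, hx']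
  | mul h a =>
    rw [hF, ← mul_assoc, canonicalCondExp_mul_ofLeft, hy]
    rfl

/-! ### Relative commutant, freeness and uniqueness of the expectation -/

theorem mem_centralizer_copy {y : CrossedProduct ρ} :
    y ∈ (copy ρ).centralizer ↔ ∀ a, ofLeft ρ a * y = y * ofLeft ρ a := by
  rw [Set.mem_centralizer_iff]
  exact Set.forall_mem_range

theorem centralizer_copy_eq_iff :
    (copy ρ).centralizer = (copy ρ).centralizer ∩ copy ρ ↔
      ∀ y : CrossedProduct ρ, (∀ a, ofLeft ρ a * y = y * ofLeft ρ a) → ∃ c, y = ofLeft ρ c := by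
  rw [eq_comm, Set.inter_eq_left]
  refine forall_congr' fun y => imp_congr (mem_centralizer_copy ρ) ?_
  exact exists_congr fun c => eq_comm

/-- The Fourier transform of `y` intertwines exactly when `y` commutes with `A`. -/
theorem commute_iff_intertwines (y : CrossedProduct ρ) (a : A) :
    ofLeft ρ a * y = y * ofLeft ρ a ↔ ∀ h : H, ∑ i ∈ (ℛ ℂ h).index,
      𝓔 ρ (y * ofRight ρ (antipode ℂ ((ℛ ℂ h).left i))) * ρ.act ((ℛ ℂ h).right i) a =
        a * 𝓔 ρ (y * ofRight ρ (antipode ℂ h)) := by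
  have key (h : H) : 𝓔 ρ (y * ofLeft ρ a * ofRight ρ (antipode ℂ h)) = ∑ i ∈ (ℛ ℂ h).index,
      𝓔 ρ (y * ofRight ρ (antipode ℂ ((ℛ ℂ h).left i))) * ρ.act ((ℛ ℂ h).right i) a := by
    rw [mul_assoc, ofLeft_mul_ofRight_antipode ρ h (ℛ ℂ h), Finset.mul_sum, map_sum]
    simp only [← mul_assoc, canonicalCondExp_mul_ofLeft]
  constructor
  · intro h k
    rw [← key, ← h, mul_assoc, canonicalCondExp_ofLeft_mul]
  · intro h
    refine ext_canonicalCondExp ρ fun k => ?_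
    -- S is bijective, so testing against V(S k) for all k suffices.
    obtain ⟨k, rfl⟩ := LinearMap.injective_iff_surjective.mp (antipode_injective (H := H)) k
    rw [key, h, mul_assoc, canonicalCondExp_ofLeft_mul]

theorem mul_coaction_eq_iff (x : A ⊗[ℂ] Dual H) (a : A) :
    x * ρ a = (a ⊗ₜ[ℂ] (1 : Dual H)) * x ↔ ∀ h : H, ∑ i ∈ (ℛ ℂ h).index,
      slice A ((ℛ ℂ h).left i) x * ρ.act ((ℛ ℂ h).right i) a = a * slice A h x := by
  have key (h : H) : slice A h ((a ⊗ₜ[ℂ] (1 : Dual H)) * x) = a * slice A h x := by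
    induction x using TensorProduct.induction_on with
    | zero => simp
    | add x y hx hy => simp only [mul_add, map_add, hx, hy]
    | tmul b φ => simp [slice_tmul]
  simp only [← key, ρ.act_apply, ← slice_mul]
  exact ⟨fun h k => by rw [h], slice_ext⟩

/-- The transform y ↦ (h ↦ E(y V(S h))) matches the two quantifiers. Centrality of c is automatic: c
commutes with A in the crossed product, where A embeds injectively. -/
theorem isFree_iff : ρ.IsFree ↔
    ∀ y : CrossedProduct ρ, (∀ a, ofLeft ρ a * y = y * ofLeft ρ a) → ∃ c, y = ofLeft ρ c := by
  have hτ (h : H) : Dual.tau H h = haarTrace H h := by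
    rw [← Dual.toFunctional_apply, Dual.toFunctional_tau]
  let S : H ≃ₗ[ℂ] H := LinearEquiv.ofBijective (antipode ℂ)
    ⟨antipode_injective, LinearMap.injective_iff_surjective.mp antipode_injective⟩
  have hS (h : H) : S.symm (antipode ℂ h) = h := S.symm_apply_apply h
  constructor
  · intro hfree y hy
    obtain ⟨x, hx⟩ := exists_slice_eq
      (𝓔 ρ ∘ₗ LinearMap.mulLeft ℂ y ∘ₗ (ofRight ρ).toLinearMap ∘ₗ antipode ℂ)
    replace hx (h : H) : slice A h x = 𝓔 ρ (y * ofRight ρ (antipode ℂ h)) := hx h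
    obtain ⟨c, -, rfl⟩ := hfree x fun a => by
      rw [mul_coaction_eq_iff]
      simpa only [hx] using (commute_iff_intertwines ρ y a).mp (hy a)
    refine ⟨c, ext_canonicalCondExp ρ fun k => ?_⟩
    obtain ⟨k, rfl⟩ := S.surjective k
    change 𝓔 ρ (y * ofRight ρ (antipode ℂ k)) = 𝓔 ρ (_ * ofRight ρ (antipode ℂ k))
    rw [← hx, slice_tmul, canonicalCondExp_ofLeft_mul_ofRight, haarTrace_antipode, hτ]
  · intro hc x hx
    obtain ⟨y, hy⟩ := exists_canonicalCondExp_mul_eq ρ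
      ({ toFun := fun h => slice A (S.symm h) x
         map_add' := fun h k => by rw [map_add, slice_add]
         map_smul' := fun c h => by rw [map_smul, slice_smul, RingHom.id_apply] } : H →ₗ[ℂ] A)
    replace hy (h : H) : slice A h x = 𝓔 ρ (y * ofRight ρ (antipode ℂ h)) := by
      rw [hy]
      change _ = slice A (S.symm (antipode ℂ h)) x
      rw [hS]
    have hcomm (a : A) : ofLeft ρ a * y = y * ofLeft ρ a := by
      rw [commute_iff_intertwines]
      simpa only [hy] using (mul_coaction_eq_iff ρ x a).mp (hx a)
    obtain ⟨c, rfl⟩ := hc y hcomm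
    refine ⟨c, Semigroup.mem_center_iff.mpr fun a => ?_, slice_ext fun k => ?_⟩
    · exact ofLeft_injective ρ (by rw [map_mul, map_mul, hcomm])
    · rw [hy, canonicalCondExp_ofLeft_mul_ofRight, haarTrace_antipode, slice_tmul, hτ]

theorem eq_canonicalCondExp_of_centralizer
    (hc : ∀ y : CrossedProduct ρ, (∀ a, ofLeft ρ a * y = y * ofLeft ρ a) → ∃ c, y = ofLeft ρ c)
    {F : CrossedProduct ρ →ₗ[ℂ] A} (hF : IsCondExp F) : F = 𝓔 ρ := by
  obtain ⟨y, hy⟩ := exists_eq_canonicalCondExp_mul ρ hF.mul_right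
  obtain ⟨c, rfl⟩ := hc y fun a => ext_canonicalCondExp ρ fun k => by
    rw [mul_assoc, canonicalCondExp_ofLeft_mul, mul_assoc, ← hy, ← hy]
    exact (hF.mul_left a _).symm
  have h1 : c = 1 := by
    have := hy (ofLeft ρ 1)
    rw [canonicalCondExp_ofLeft_mul, canonicalCondExp_ofLeft, mul_one] at this
    exact this.symm.trans (hF.apply_of 1)
  ext1 x
  rw [hy, h1, map_one, one_mul]

/-- The conditional expectation obtained by perturbing the canonical one in the direction of an
element of the relative commutant. -/
theorem perturbed_isCondExp {y : CrossedProduct ρ} (hy : ∀ a, ofLeft ρ a * y = y * ofLeft ρ a)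
    {t : ℝ} {w : A}
    (hw : 1 - ((t ^ 2 : ℝ) : ℂ) • 𝓔 ρ (star y * y) = star w * w) :
    IsCondExp (LinearMap.mulLeft ℂ (1 - ((t ^ 2 : ℝ) : ℂ) • 𝓔 ρ (star y * y)) ∘ₗ 𝓔 ρ +
      ((t ^ 2 : ℝ) : ℂ) • 𝓔 ρ ∘ₗ LinearMap.mulLeft ℂ (star y) ∘ₗ LinearMap.mulRight ℂ y) := by
  set s : ℂ := ((t ^ 2 : ℝ) : ℂ) with hs
  have hy' (a) : ofLeft ρ a * star y = star y * ofLeft ρ a := by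
    have := congrArg star (hy (star a))
    simpa [star_mul, star_ofLeft] using this.symm
  -- Since y and y* commute with A, E(y*y) is central in A; this makes the perturbed map a bimodule
  -- map.
  have hz (a : A) : a * 𝓔 ρ (star y * y) = 𝓔 ρ (star y * y) * a := by
    rw [← canonicalCondExp_ofLeft_mul, ← mul_assoc, hy', mul_assoc, hy, ← mul_assoc,
      canonicalCondExp_mul_ofLeft]
  set z := 𝓔 ρ (star y * y) with hzdef
  have happ (x) : (LinearMap.mulLeft ℂ (1 - s • z) ∘ₗ 𝓔 ρ +
      s • 𝓔 ρ ∘ₗ LinearMap.mulLeft ℂ (star y) ∘ₗ LinearMap.mulRight ℂ y) x =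
        (1 - s • z) * 𝓔 ρ x + s • 𝓔 ρ (star y * (x * y)) := rfl
  have hcomm (a : A) : a * (1 - s • z) = (1 - s • z) * a := by
    rw [mul_sub, sub_mul, mul_smul_comm, smul_mul_assoc, hz, mul_one, one_mul]
  constructor
  · intro a
    rw [happ, ← ofLeft_apply, canonicalCondExp_ofLeft, hy, ← mul_assoc,
      canonicalCondExp_mul_ofLeft, sub_mul, one_mul, smul_mul_assoc, sub_add_cancel]
  · intro a x
    rw [happ, happ, ← ofLeft_apply, canonicalCondExp_ofLeft_mul, mul_assoc (ofLeft ρ a),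
      ← mul_assoc (star y), ← hy', mul_assoc (ofLeft ρ a), canonicalCondExp_ofLeft_mul,
      ← mul_assoc, ← hcomm, mul_add, mul_assoc, mul_smul_comm]
  · intro x a
    rw [happ, happ, ← ofLeft_apply, canonicalCondExp_mul_ofLeft, mul_assoc x, hy, ← mul_assoc x,
      ← mul_assoc (star y), canonicalCondExp_mul_ofLeft, add_mul, mul_assoc, smul_mul_assoc]
  · intro x
    obtain ⟨v, hv⟩ := (canonicalCondExp_isCondExp ρ).positive x
    obtain ⟨u, hu⟩ := (canonicalCondExp_isCondExp ρ).positive (x * y)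
    obtain ⟨c, hc⟩ := exists_add_star_mul_self (w * v) ((t : ℂ) • u)
    refine ⟨c, ?_⟩
    rw [← hc, happ]
    -- By centrality of w*w the first summand is (wv)*(wv); the second is t² E((xy)*(xy)).
    congr 1
    · rw [hv, star_mul, mul_assoc (star v), ← mul_assoc (star w), ← hw, ← mul_assoc, ← mul_assoc,
        hcomm]
    · have : star y * (star x * x * y) = star (x * y) * (x * y) := by
        rw [star_mul]
        simp only [mul_assoc]
      rw [this, hu, star_smul, smul_mul_smul_comm, hs]
      congr 1
      simp [pow_two]

theorem exists_eq_ofLeft_of_unique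
    (hF : ∀ F : CrossedProduct ρ →ₗ[ℂ] A, IsCondExp F → F = 𝓔 ρ) (y : CrossedProduct ρ)
    (hy : ∀ a, ofLeft ρ a * y = y * ofLeft ρ a) : ∃ c, y = ofLeft ρ c := by
  have hdiag (u : CrossedProduct ρ) (hu : ∀ a, ofLeft ρ a * u = u * ofLeft ρ a)
      (x : CrossedProduct ρ) : 𝓔 ρ (star u * (x * u)) = 𝓔 ρ (star u * u) * 𝓔 ρ x := by
    obtain ⟨v, hv⟩ := (canonicalCondExp_isCondExp ρ).positive u
    obtain ⟨t, ht, w, hw⟩ := exists_one_sub_smul_star_mul_self v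
    rw [← hv] at hw
    have h := congrArg (fun F => F x) (hF _ (perturbed_isCondExp ρ hu hw))
    have h' : (1 - ((t ^ 2 : ℝ) : ℂ) • 𝓔 ρ (star u * u)) * 𝓔 ρ x +
      ((t ^ 2 : ℝ) : ℂ) • 𝓔 ρ (star u * (x * u)) = 𝓔 ρ x := h
    rw [sub_mul, one_mul, smul_mul_assoc, sub_add_eq_add_sub, add_sub_assoc, add_eq_left,
      ← smul_sub, smul_eq_zero] at h'
    rcases h' with h' | h'
    · exact absurd h' (by exact_mod_cast (pow_pos ht 2).ne')
    · exact sub_eq_zero.mp h'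
  -- Polarization of `hdiag` at 1 + u and 1 + iu: the first controls the sum of the cross terms in
  -- u* and u, the second their difference, and i times the first minus the second isolates u*.
  have hmul (u : CrossedProduct ρ) (hu : ∀ a, ofLeft ρ a * u = u * ofLeft ρ a)
      (x : CrossedProduct ρ) : 𝓔 ρ (star u * x) = 𝓔 ρ (star u) * 𝓔 ρ x := by
    have h0 := hdiag u hu x
    have h1 := hdiag (1 + u) (fun a => by rw [mul_add, add_mul, hu, mul_one, one_mul]) x
    have h2 := hdiag (1 + Complex.I • u)
      (fun a => by rw [mul_add, add_mul, mul_smul_comm, smul_mul_assoc, hu, mul_one, one_mul]) x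
    have hE : 𝓔 ρ (1 : CrossedProduct ρ) = 1 := canonicalCondExp_ofLeft ρ 1
    simp only [star_add, star_one, star_smul, add_mul, mul_add, one_mul, mul_one, map_add,
      map_smul, smul_mul_assoc, mul_smul_comm, hE, h0] at h1 h2
    simp only [RCLike.star_def, Complex.conj_I, neg_smul] at h2
    have h3 : (2 * Complex.I) • (𝓔 ρ (star u * x) - 𝓔 ρ (star u) * 𝓔 ρ x) = 0 := by
      linear_combination (norm := module) Complex.I • h1 - h2
    exact sub_eq_zero.mp ((smul_eq_zero.mp h3).resolve_left (by simp))
  have hy' (a) : ofLeft ρ a * star y = star y * ofLeft ρ a := by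
    have := congrArg star (hy (star a))
    simpa [star_mul, star_ofLeft] using this.symm
  refine ⟨𝓔 ρ y, ext_canonicalCondExp ρ fun k => ?_⟩
  have := hmul (star y) hy' (ofRight ρ k)
  rwa [star_star, ← canonicalCondExp_ofLeft_mul] at this

end CrossedProduct

end CStarHopf

end

theorem mainTheorem2 {A : Type*} [CStarAlgebra A] {H : Type*}
    [CStarHopf.FinDimCStarHopfAlgebra H] (ρ : CStarHopf.Coaction A H) :
    List.TFAE
      [ρ.IsFree,
       (CStarHopf.CrossedProduct.copy ρ).centralizer =
         (CStarHopf.CrossedProduct.copy ρ).centralizer ∩ CStarHopf.CrossedProduct.copy ρ,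
       CStarHopf.CrossedProduct.IsCondExp (CStarHopf.CrossedProduct.canonicalCondExp ρ) ∧
         ∀ F : CStarHopf.CrossedProduct ρ →ₗ[ℂ] A,
           CStarHopf.CrossedProduct.IsCondExp F →
             F = CStarHopf.CrossedProduct.canonicalCondExp ρ] := by
  have hcentral := CStarHopf.CrossedProduct.centralizer_copy_eq_iff ρ
  tfae_have 1 ↔ 2 := (CStarHopf.CrossedProduct.isFree_iff ρ).trans hcentral.symm
  tfae_have 2 → 3 := fun h => ⟨CStarHopf.CrossedProduct.canonicalCondExp_isCondExp ρ,
    fun _ => CStarHopf.CrossedProduct.eq_canonicalCondExp_of_centralizer ρ (hcentral.mp h)⟩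
  tfae_have 3 → 2 := fun h => hcentral.mpr
    (CStarHopf.CrossedProduct.exists_eq_ofLeft_of_unique ρ h.2)
  tfae_finish
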